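/- Let $\gamma>0$ and let $A$ be the operator on $L^2(0,1)$ with domain $H^1_0(0,1)=\{f\in H^1(0,1): f(0)=f(1)=0\}$ and $(Af)(x)=if'(x)+i\frac{\gamma}{x}f(x)$, where $f'$ is the weak derivative. Inner products are linear in the second component. A densely defined operator $T$ is called dissipative if $\mathrm{Im}\langle f,Tf\rangle\ge 0$ for all $f\in\mathcal D(T)$, and maximally dissipative if it is dissipative and has no non-trivial dissipative operator extension. Let $A_0$ be the restriction of $A$ to $C_c^\infty(0,1)$, let $V_{A_0}^{-1/2}$ be the operator of multiplication by $\sqrt{x/\gamma}$ on $L^2(0,1)$, and let $W_{A_0}=A_0V_{A_0}^{-1/2}$ on $\mathcal D(W_{A_0})=\{g\in L^2(0,1): V_{A_0}^{-1/2}g\in C_c^\infty(0,1)\}$. The adjoint $W_{A_0}^*$ has the domain $$\mathcal D(W_{A_0}^*)=\left\{v\in L^2(0,1):\ \sqrt{x}\,v(x)\in H^1_0(0,1)\dotplus\mathrm{span}\{x^{\gamma+1/2}\}\right\}.$$ For $v\in\mathcal D(W_{A_0}^*)\setminus H^1_0(0,1)$ and $\ell\in L^2(0,1)$, let $A_{v,\ell}$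 be the operator $$\mathcal D(A_{v,\ell})=H^1_0(0,1)\dotplus\mathrm{span}\{v\},\qquad A_{v,\ell}(f+\lambda v)=Af+\lambda\ell\qquad(f\in H^1_0(0,1),\ \lambda\in\mathbb C).$$ Then an operator $B$ on $L^2(0,1)$ is a maximally dissipative extension of $A$ if and only if $B=A_{v,\ell}$ for some $v\in\mathcal D(W_{A_0}^*)\setminus H^1_0(0,1)$ and $\ell\in L^2(0,1)$ satisfying $$\mathrm{Im}\langle v,\ell\rangle\ \ge\ \frac14\int_0^1\left|\sqrt{\frac{x}{\gamma}}\,\ell(x)-i\left(\sqrt{\frac{x}{\gamma}}\,v(x)\right)'+i\,\frac{2\gamma+1}{2\sqrt{\gamma x}}\,v(x)\right|^2\mathrm dx .$$ -/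

import Mathlib

open MeasureTheory Set
open scoped ContDiff

namespace SingularFirstOrder

/-- Membership in `C_c^∞(0,1)`: smooth with compact support contained in the open interval `(0,1)`. -/
structure IsTest {F : Type*} [NormedAddCommGroup F] [NormedSpace ℝ F] (φ : ℝ → F) : Prop where
  smooth : ContDiff ℝ ∞ φ
  compact : HasCompactSupport φ
  supp : tsupport φ ⊆ Ioo (0 : ℝ) 1

theorem IsTest.exists_Icc {F : Type*} [NormedAddCommGroup F] [NormedSpace ℝ F] {φ : ℝ → F}
    (h : IsTest φ) : ∃ a b : ℝ, 0 < a ∧ b < 1 ∧ a ≤ b ∧ ∀ x, x ∉ Icc a b → φ x = 0 := by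
  rcases (tsupport φ).eq_empty_or_nonempty with he | hne
  · refine ⟨1/2, 1/2, by norm_num, by norm_num, le_rfl, fun x _ => ?_⟩
    exact image_eq_zero_of_notMem_tsupport (by simp [he])
  · have hc : IsCompact (tsupport φ) := h.compact
    obtain ⟨a, ha, ha'⟩ := hc.exists_isLeast hne
    obtain ⟨b, hb, hb'⟩ := hc.exists_isGreatest hne
    refine ⟨a, b, (h.supp ha).1, (h.supp hb).2, ha' hb, fun x hx => ?_⟩
    refine image_eq_zero_of_notMem_tsupport fun hx' => hx ⟨ha' hx', hb' hx'⟩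

theorem IsTest.of_Icc {F : Type*} [NormedAddCommGroup F] [NormedSpace ℝ F] {φ : ℝ → F}
    (hs : ContDiff ℝ ∞ φ) {a b : ℝ} (ha : 0 < a) (hb : b < 1)
    (h : ∀ x, x ∉ Icc a b → φ x = 0) : IsTest φ := by
  have : tsupport φ ⊆ Icc a b := closure_minimal (fun x hx => by
    by_contra hx'; exact hx (h x hx')) isClosed_Icc
  exact ⟨hs, isCompact_Icc.of_isClosed_subset (isClosed_tsupport φ) this,
    this.trans fun x hx => ⟨ha.trans_le hx.1, hx.2.trans_lt hb⟩⟩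

/-- A test function with mean zero is the derivative of a test function. -/
theorem IsTest.exists_primitive {θ : ℝ → ℝ} (h : IsTest θ)
    (h0 : ∫ x in Ioo (0 : ℝ) 1, θ x = 0) : ∃ Θ : ℝ → ℝ, IsTest Θ ∧ deriv Θ = θ := by
  obtain ⟨a, b, ha, hb, hab, hz⟩ := h.exists_Icc
  have hc : Continuous θ := h.smooth.continuous
  have hd : ∀ x, HasDerivAt (fun x => ∫ t in (0 : ℝ)..x, θ t) (θ x) x := fun x =>
    intervalIntegral.integral_hasDerivAt_right (hc.intervalIntegrable _ _)
      (hc.stronglyMeasurableAtFilter _ _) hc.continuousAt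
  have hder : deriv (fun x => ∫ t in (0 : ℝ)..x, θ t) = θ := funext fun x => (hd x).deriv
  refine ⟨fun x => ∫ t in (0 : ℝ)..x, θ t, IsTest.of_Icc ?_ ha hb ?_, hder⟩
  · rw [contDiff_infty_iff_deriv, hder]
    exact ⟨fun x => (hd x).differentiableAt, h.smooth⟩
  · intro x hx
    by_cases hxa : x < a
    · refine (intervalIntegral.integral_congr (g := fun _ => (0 : ℝ)) fun t ht => ?_).trans
        (by simp)
      refine hz t fun ht' => ?_
      have := ht.2
      have h3 : max 0 x < a := max_lt ha hxa
      exact absurd (ht'.1.trans this) (not_le.2 h3)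
    · have hbx : b < x := by
        by_contra hbx; exact hx ⟨not_lt.1 hxa, not_lt.1 hbx⟩
      have h1 : ∫ t in (0 : ℝ)..1, θ t = 0 := by
        rw [intervalIntegral.integral_of_le zero_le_one, integral_Ioc_eq_integral_Ioo]; exact h0
      have h2 : ∫ t in x..1, θ t = 0 := by
        refine (intervalIntegral.integral_congr (g := fun _ => (0 : ℝ)) fun t ht => ?_).trans
          (by simp)
        refine hz t fun ht' => ?_
        have h3 : b < min x 1 := lt_min hbx hb
        exact absurd (h3.trans_le (ht.1.trans ht'.2)) (lt_irrefl _)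
      have := intervalIntegral.integral_add_adjacent_intervals (μ := volume)
        (hc.intervalIntegrable 0 x) (hc.intervalIntegrable x 1)
      show ∫ t in (0 : ℝ)..x, θ t = 0
      linarith

theorem setIntegral_test {φ h : ℝ → ℝ} (hφ : IsTest φ) :
    ∫ x in Ioo (0 : ℝ) 1, φ x * h x = ∫ x, φ x * h x := by
  refine setIntegral_eq_integral_of_forall_compl_eq_zero fun x hx => ?_
  rw [image_eq_zero_of_notMem_tsupport fun h' => hx (hφ.supp h'), zero_mul]

theorem integrable_mul_test {φ h : ℝ → ℝ} (hφ : IsTest φ)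
    (hh : IntegrableOn h (Ioo (0 : ℝ) 1)) :
    IntegrableOn (fun x => φ x * h x) (Ioo (0 : ℝ) 1) := by
  obtain ⟨C, hC⟩ := hφ.compact.exists_bound_of_continuous hφ.smooth.continuous
  exact Integrable.bdd_mul hh hφ.smooth.continuous.aestronglyMeasurable
    (Filter.Eventually.of_forall hC)

/-- du Bois-Reymond lemma on `(0,1)`. -/
theorem ae_const_of_integral_deriv {h : ℝ → ℝ} (hh : IntegrableOn h (Ioo (0 : ℝ) 1))
    (H : ∀ φ : ℝ → ℝ, IsTest φ → ∫ x in Ioo (0 : ℝ) 1, deriv φ x * h x = 0) :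
    ∃ c : ℝ, ∀ᵐ x ∂(volume.restrict (Ioo (0 : ℝ) 1)), h x = c := by
  let ψ₀ : ContDiffBump (1/2 : ℝ) := ⟨1/8, 1/4, by norm_num, by norm_num⟩
  set ψ : ℝ → ℝ := ψ₀.normed volume with hψ
  have hψT : IsTest ψ := by
    refine ⟨ψ₀.contDiff_normed, ψ₀.hasCompactSupport_normed, ?_⟩
    rw [hψ, ψ₀.tsupport_normed_eq, Real.closedBall_eq_Icc]
    intro x hx
    have h1 := hx.1
    have h2 := hx.2
    simp only [ψ₀] at h1 h2
    constructor <;> linarith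
  have hψ1 : ∫ x in Ioo (0 : ℝ) 1, ψ x = 1 := by
    have := setIntegral_test (h := fun _ => 1) hψT
    simp only [mul_one] at this
    rw [this]; exact ψ₀.integral_normed
  refine ⟨∫ x in Ioo (0 : ℝ) 1, ψ x * h x, ?_⟩
  set c := ∫ x in Ioo (0 : ℝ) 1, ψ x * h x with hcdef
  have hfin : IntegrableOn (fun _ : ℝ => c) (Ioo (0 : ℝ) 1) := by simp
  have key := isOpen_Ioo.ae_eq_zero_of_integral_contDiff_smul_eq_zero (μ := volume)
    (f := fun x => h x - c) (U := Ioo (0 : ℝ) 1) (hh.sub hfin).locallyIntegrableOn ?_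
  · rw [ae_restrict_iff' measurableSet_Ioo]
    filter_upwards [key] with x hx hx'
    exact sub_eq_zero.1 (hx hx')
  · intro g hg1 hg2 hg3
    have hg : IsTest g := ⟨hg1, hg2, hg3⟩
    have hgi : IntegrableOn g (Ioo (0 : ℝ) 1) := by
      simpa using integrable_mul_test (h := fun _ => 1) hg (by simp)
    have hψi : IntegrableOn ψ (Ioo (0 : ℝ) 1) := by
      simpa using integrable_mul_test (h := fun _ => 1) hψT (by simp)
    set m := ∫ x in Ioo (0 : ℝ) 1, g x with hm
    have hθ : IsTest (fun x => g x - m * ψ x) := by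
      refine ⟨hg1.sub (contDiff_const.mul hψT.smooth), hg2.sub hψT.compact.mul_left, ?_⟩
      refine (tsupport_sub _ _).trans (union_subset hg3 ?_)
      exact (tsupport_mul_subset_right (f := fun _ => m) (g := ψ)).trans hψT.supp
    have hθ0 : ∫ x in Ioo (0 : ℝ) 1, (g x - m * ψ x) = 0 := by
      rw [integral_sub hgi (hψi.const_mul m), integral_const_mul, hψ1, ← hm]; ring
    obtain ⟨Θ, hΘ, hΘd⟩ := hθ.exists_primitive hθ0
    have := H Θ hΘ
    rw [hΘd] at this
    simp only [smul_eq_mul]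
    rw [← setIntegral_test hg]
    have i1 := integrable_mul_test hg hh
    have i2 := (integrable_mul_test hψT hh).const_mul m
    have e1 : ∫ x in Ioo (0 : ℝ) 1, (g x - m * ψ x) * h x
        = (∫ x in Ioo (0 : ℝ) 1, g x * h x) - m * c := by
      rw [hcdef, ← integral_const_mul, ← integral_sub i1 i2]
      congr 1; ext x; ring
    have e2 : ∫ x in Ioo (0 : ℝ) 1, g x * (h x - c)
        = (∫ x in Ioo (0 : ℝ) 1, g x * h x) - m * c := by
      rw [hm, ← integral_mul_const, ← integral_sub i1 (hgi.mul_const c)]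
      congr 1; ext x; ring
    rw [e2, ← e1, this]

/-- A real function with weak derivative `g` is a constant plus the primitive of `g`. -/
theorem ae_eq_primitive {f g : ℝ → ℝ} (hf : IntegrableOn f (Ioo (0 : ℝ) 1))
    (hg : IntegrableOn g (Ioo (0 : ℝ) 1))
    (H : ∀ φ : ℝ → ℝ, IsTest φ →
      ∫ x in Ioo (0 : ℝ) 1, deriv φ x * f x = -∫ x in Ioo (0 : ℝ) 1, φ x * g x) :
    ∃ c : ℝ, ∀ᵐ x ∂(volume.restrict (Ioo (0 : ℝ) 1)), f x = c + ∫ t in (0 : ℝ)..x, g t := by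
  have hgI : IntervalIntegrable g volume 0 1 := by
    rw [intervalIntegrable_iff_integrableOn_Ioo_of_le zero_le_one]; exact hg
  have hac := hgI.absolutelyContinuousOnInterval_intervalIntegral (c := 0) (by simp)
  have hGc : IntegrableOn (fun x => ∫ t in (0 : ℝ)..x, g t) (Ioo (0 : ℝ) 1) := by
    have := hac.continuousOn
    rw [uIcc_of_le zero_le_one] at this
    exact (this.integrableOn_Icc).mono_set Ioo_subset_Icc_self
  suffices key : ∀ φ : ℝ → ℝ, IsTest φ →
      ∫ x in Ioo (0 : ℝ) 1, deriv φ x * (f x - ∫ t in (0 : ℝ)..x, g t) = 0 by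
    obtain ⟨c, hc⟩ := ae_const_of_integral_deriv (hf.sub hGc) key
    exact ⟨c, hc.mono fun x hx => by simp only [Pi.sub_apply] at hx; linarith⟩
  · intro φ hφ
    have hφac : AbsolutelyContinuousOnInterval φ 0 1 :=
      (hφ.smooth.of_le (by exact_mod_cast le_top)).contDiffOn.absolutelyContinuousOnInterval
    have ibp := hac.integral_mul_deriv_eq_deriv_mul hφac
    have z0 : φ 0 = 0 := image_eq_zero_of_notMem_tsupport fun h' => by simpa using (hφ.supp h').1
    have z1 : φ 1 = 0 := image_eq_zero_of_notMem_tsupport fun h' => by simpa using (hφ.supp h').2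
    have e1 : ∫ x in (0 : ℝ)..1, deriv (fun x => ∫ t in (0 : ℝ)..x, g t) x * φ x
        = ∫ x in (0 : ℝ)..1, φ x * g x := by
      refine intervalIntegral.integral_congr_ae ?_
      filter_upwards [hgI.ae_hasDerivAt_integral] with x hx hx'
      rw [(hx (uIoc_subset_uIcc hx') 0 (by simp)).deriv, mul_comm]
    rw [e1, z0, z1] at ibp
    simp only [intervalIntegral.integral_of_le zero_le_one, integral_Ioc_eq_integral_Ioo] at ibp
    have hφd : IsTest (deriv φ) := ⟨(contDiff_infty_iff_deriv.1 hφ.smooth).2,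
      hφ.compact.deriv, (closure_minimal ((support_deriv_subset)) (isClosed_tsupport _)).trans hφ.supp⟩
    have e2 := integral_sub (integrable_mul_test hφd hf) (integrable_mul_test hφd hGc)
    simp only [← mul_sub] at e2
    rw [e2, H φ hφ]
    simp only [mul_comm (deriv φ _)]
    rw [ibp]; ring

open ENNReal in
theorem lintegral_rpow_neg_half {x : ℝ} (hx : 0 < x) :
    ∫⁻ t in Ioo (0 : ℝ) x, ENNReal.ofReal (t ^ (-(1/2) : ℝ)) = ENNReal.ofReal (2 * x ^ (1/2 : ℝ)) := by
  rw [← ofReal_integral_eq_lintegral_ofReal]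
  · rw [← integral_Ioc_eq_integral_Ioo, ← intervalIntegral.integral_of_le hx.le,
      integral_rpow (Or.inl (by norm_num))]
    congr 1
    norm_num
    ring
  · have := intervalIntegral.intervalIntegrable_rpow' (a := 0) (b := x) (r := -(1/2)) (by norm_num)
    rwa [intervalIntegrable_iff_integrableOn_Ioo_of_le hx.le] at this
  · exact (ae_restrict_iff' measurableSet_Ioo).2 (Filter.Eventually.of_forall fun t ht =>
      Real.rpow_nonneg ht.1.le _)

theorem lintegral_rpow_neg_three_half {t : ℝ} (ht : 0 < t) (ht1 : t < 1) :
    ∫⁻ x in Ioo t 1, ENNReal.ofReal (2 * x ^ (-(3/2) : ℝ))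
      ≤ ENNReal.ofReal (4 * t ^ (-(1/2) : ℝ)) := by
  rw [← ofReal_integral_eq_lintegral_ofReal]
  · rw [← integral_Ioc_eq_integral_Ioo, ← intervalIntegral.integral_of_le ht1.le,
      intervalIntegral.integral_const_mul,
      integral_rpow (Or.inr ⟨by norm_num, by
        rw [uIcc_of_le ht1.le]; exact fun h => absurd h.1 (not_le.2 ht)⟩)]
    refine ENNReal.ofReal_le_ofReal ?_
    norm_num
    have := Real.rpow_nonneg ht.le (-(1/2) : ℝ)
    norm_num at this
    linarith
  · have := (intervalIntegral.intervalIntegrable_rpow (μ := volume) (a := t) (b := 1)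
      (r := -(3/2)) (Or.inr (by
        rw [uIcc_of_le ht1.le]; exact fun h => absurd h.1 (not_le.2 ht)))).const_mul 2
    rwa [intervalIntegrable_iff_integrableOn_Ioo_of_le ht1.le] at this
  · exact (ae_restrict_iff' measurableSet_Ioo).2 (Filter.Eventually.of_forall fun x hx =>
      mul_nonneg zero_le_two (Real.rpow_nonneg (ht.trans hx.1).le _))

theorem sq_lintegral_le {g : ℝ → ENNReal} (hg : Measurable g) {x : ℝ} (hx : 0 < x) :
    (∫⁻ t in Ioo (0 : ℝ) x, g t) ^ 2 ≤ ENNReal.ofReal (2 * x ^ (1/2 : ℝ)) *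
      ∫⁻ t in Ioo (0 : ℝ) x, ENNReal.ofReal (t ^ (1/2 : ℝ)) * g t ^ 2 := by
  have h := ENNReal.lintegral_mul_le_Lp_mul_Lq (volume.restrict (Ioo 0 x))
    (Real.HolderConjugate.two_two)
    (f := fun t => ENNReal.ofReal (t ^ (-(1/4) : ℝ)))
    (g := fun t => ENNReal.ofReal (t ^ (1/4 : ℝ)) * g t) (by fun_prop) (by fun_prop)
  have e0 : ∫⁻ t in Ioo (0 : ℝ) x, ((fun t => ENNReal.ofReal (t ^ (-(1/4) : ℝ))) *
      fun t => ENNReal.ofReal (t ^ (1/4 : ℝ)) * g t) t = ∫⁻ t in Ioo (0 : ℝ) x, g t := by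
    refine setLIntegral_congr_fun measurableSet_Ioo fun t ht => ?_
    simp only [Pi.mul_apply]
    rw [← mul_assoc, ← ENNReal.ofReal_mul (Real.rpow_nonneg ht.1.le _), ← Real.rpow_add ht.1]
    norm_num
  have e1 : ∫⁻ t in Ioo (0 : ℝ) x, ENNReal.ofReal (t ^ (-(1/4) : ℝ)) ^ (2 : ℝ)
      = ENNReal.ofReal (2 * x ^ (1/2 : ℝ)) := by
    rw [← lintegral_rpow_neg_half hx]
    refine setLIntegral_congr_fun measurableSet_Ioo fun t ht => ?_
    rw [ENNReal.ofReal_rpow_of_nonneg (Real.rpow_nonneg ht.1.le _) zero_le_two,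
      ← Real.rpow_mul ht.1.le]
    norm_num
  have e2 : ∫⁻ t in Ioo (0 : ℝ) x, (ENNReal.ofReal (t ^ (1/4 : ℝ)) * g t) ^ (2 : ℝ)
      = ∫⁻ t in Ioo (0 : ℝ) x, ENNReal.ofReal (t ^ (1/2 : ℝ)) * g t ^ 2 := by
    refine setLIntegral_congr_fun measurableSet_Ioo fun t ht => ?_
    rw [ENNReal.mul_rpow_of_nonneg _ _ zero_le_two,
      ENNReal.ofReal_rpow_of_nonneg (Real.rpow_nonneg ht.1.le _) zero_le_two,
      ← Real.rpow_mul ht.1.le, ENNReal.rpow_two]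
    norm_num
  rw [e0, e1, e2] at h
  calc _ ≤ _ := pow_le_pow_left' h 2
    _ = _ := by
      rw [mul_pow, ← ENNReal.rpow_two, ← ENNReal.rpow_two, ← ENNReal.rpow_mul, ← ENNReal.rpow_mul]
      norm_num

/-- Hardy's inequality on `(0,1)`. -/
theorem hardy {g : ℝ → ENNReal} (hg : Measurable g) :
    ∫⁻ x in Ioo (0 : ℝ) 1, (ENNReal.ofReal x⁻¹ * ∫⁻ t in Ioo (0 : ℝ) x, g t) ^ 2
      ≤ 4 * ∫⁻ t in Ioo (0 : ℝ) 1, g t ^ 2 := by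
  set k : ℝ → ℝ → ENNReal := fun x t => (Ioo (0 : ℝ) x).indicator
    (fun t => ENNReal.ofReal (t ^ (1/2 : ℝ)) * g t ^ 2) t with hk
  calc ∫⁻ x in Ioo (0 : ℝ) 1, (ENNReal.ofReal x⁻¹ * ∫⁻ t in Ioo (0 : ℝ) x, g t) ^ 2
      ≤ ∫⁻ x in Ioo (0 : ℝ) 1, ∫⁻ t in Ioo (0 : ℝ) 1,
          ENNReal.ofReal (2 * x ^ (-(3/2) : ℝ)) * k x t := by
        refine setLIntegral_mono' measurableSet_Ioo fun x hx => ?_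
        have hsub : Ioo (0 : ℝ) x ∩ Ioo 0 1 = Ioo 0 x := by
          rw [inter_eq_left]; exact Ioo_subset_Ioo_right hx.2.le
        rw [lintegral_const_mul' _ _ ENNReal.ofReal_ne_top, lintegral_indicator measurableSet_Ioo,
          Measure.restrict_restrict measurableSet_Ioo, hsub, mul_pow]
        refine (mul_le_mul_right (sq_lintegral_le hg hx.1) _).trans_eq ?_
        rw [← mul_assoc, ← ENNReal.ofReal_pow (inv_nonneg.2 hx.1.le),
          ← ENNReal.ofReal_mul (by positivity)]
        congr 2
        have : x⁻¹ ^ 2 = x ^ (-2 : ℝ) := by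
          rw [Real.rpow_neg hx.1.le, inv_pow]; norm_num
        rw [this, mul_left_comm, ← Real.rpow_add hx.1]
        norm_num
    _ = ∫⁻ t in Ioo (0 : ℝ) 1, ∫⁻ x in Ioo (0 : ℝ) 1,
          ENNReal.ofReal (2 * x ^ (-(3/2) : ℝ)) * k x t := by
        refine lintegral_lintegral_swap (Measurable.aemeasurable ?_)
        have : (fun p : ℝ × ℝ => k p.1 p.2) = {p : ℝ × ℝ | 0 < p.2 ∧ p.2 < p.1}.indicator
            (fun p => ENNReal.ofReal (p.2 ^ (1/2 : ℝ)) * g p.2 ^ 2) := by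
          ext p; simp [hk, indicator]
        have hm : Measurable (fun p : ℝ × ℝ => k p.1 p.2) := by
          rw [this]
          refine Measurable.indicator (by fun_prop) ?_
          exact (measurableSet_lt measurable_const measurable_snd).inter
            (measurableSet_lt measurable_snd measurable_fst)
        exact Measurable.mul (by fun_prop) hm
    _ ≤ ∫⁻ t in Ioo (0 : ℝ) 1, 4 * g t ^ 2 := by
        refine setLIntegral_mono' measurableSet_Ioo fun t ht => ?_
        have e : ∀ x, ENNReal.ofReal (2 * x ^ (-(3/2) : ℝ)) * k x t =
            (ENNReal.ofReal (t ^ (1/2 : ℝ)) * g t ^ 2) * (Ioi t).indicator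
              (fun x => ENNReal.ofReal (2 * x ^ (-(3/2) : ℝ))) x := by
          intro x
          by_cases hx : t < x
          · simp [hk, hx, ht.1, mul_comm]
          · simp [hk, hx]
        simp only [e]
        rw [lintegral_const_mul _ (by
            exact Measurable.indicator (by fun_prop) measurableSet_Ioi),
          lintegral_indicator measurableSet_Ioi, Measure.restrict_restrict measurableSet_Ioi]
        have hs : Ioi t ∩ Ioo (0 : ℝ) 1 = Ioo t 1 := by
          ext x; constructor
          · rintro ⟨h1, h2⟩; exact ⟨h1, h2.2⟩
          · rintro ⟨h1, h2⟩; exact ⟨h1, ht.1.trans h1, h2⟩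
        rw [hs]
        refine (mul_le_mul_right (lintegral_rpow_neg_three_half ht.1 ht.2) _).trans_eq ?_
        rw [mul_right_comm, ← ENNReal.ofReal_mul (Real.rpow_nonneg ht.1.le _), mul_left_comm,
          ← Real.rpow_add ht.1]
        norm_num
    _ = 4 * ∫⁻ t in Ioo (0 : ℝ) 1, g t ^ 2 := lintegral_const_mul' _ _ (by norm_num)

theorem memLp_primitive_div {f g : ℝ → ℝ} (hg : MemLp g 2 (volume.restrict (Ioo (0 : ℝ) 1)))
    (hfm : AEStronglyMeasurable f (volume.restrict (Ioo (0 : ℝ) 1)))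
    (hf : ∀ᵐ x ∂(volume.restrict (Ioo (0 : ℝ) 1)), f x = ∫ t in (0 : ℝ)..x, g t) :
    MemLp (fun x => f x / x) 2 (volume.restrict (Ioo (0 : ℝ) 1)) := by
  have hm : AEStronglyMeasurable (fun x => f x / x) (volume.restrict (Ioo (0 : ℝ) 1)) :=
    (hfm.aemeasurable.div aemeasurable_id).aestronglyMeasurable
  obtain ⟨G, hG, hgG⟩ := hg.1.aemeasurable.enorm
  have h2 : ∫⁻ t in Ioo (0 : ℝ) 1, G t ^ 2 < ⊤ := by
    have := (eLpNorm_lt_top_iff_lintegral_rpow_enorm_lt_top two_ne_zero ENNReal.ofNat_ne_top).1 hg.2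
    refine lt_of_eq_of_lt (lintegral_congr_ae ?_) this
    filter_upwards [hgG] with x hx
    rw [← hx]; simp
  refine ⟨hm, (eLpNorm_lt_top_iff_lintegral_rpow_enorm_lt_top two_ne_zero
    ENNReal.ofNat_ne_top).2 ?_⟩
  refine lt_of_le_of_lt ?_ ((hardy hG).trans_lt (ENNReal.mul_lt_top (by norm_num) h2))
  refine lintegral_mono_ae ?_
  filter_upwards [hf, ae_restrict_mem measurableSet_Ioo] with x hx hx'
  have hb : ‖f x‖ₑ ≤ ∫⁻ t in Ioo (0 : ℝ) x, G t := by
    rw [hx, intervalIntegral.integral_of_le hx'.1.le, integral_Ioc_eq_integral_Ioo]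
    refine (enorm_integral_le_lintegral_enorm _).trans_eq (lintegral_congr_ae ?_)
    exact ae_restrict_of_ae_restrict_of_subset (Ioo_subset_Ioo_right hx'.2.le) hgG
  simp only [ENNReal.toReal_ofNat, ENNReal.rpow_two]
  refine pow_le_pow_left' ?_ 2
  rw [div_eq_inv_mul, enorm_mul]
  refine mul_le_mul' (le_of_eq ?_) hb
  rw [Real.enorm_eq_ofReal (inv_nonneg.2 hx'.1.le)]

/-- The complex Hilbert space `L²(0,1)`. Its inner product `inner ℂ f g = ∫ conj f * g` is linear in the
second argument. -/
abbrev L2 : Type := Lp ℂ 2 (volume.restrict (Ioo (0 : ℝ) 1))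

/-- `g ∈ L²(0,1)` is the weak derivative of `f ∈ L²(0,1)`. -/
def HasWeakDeriv (f g : L2) : Prop :=
  ∀ φ : ℝ → ℂ, IsTest φ →
    ∫ x in Ioo (0 : ℝ) 1, f x * deriv φ x = -∫ x in Ioo (0 : ℝ) 1, g x * φ x

theorem L2.integrable (f : L2) : Integrable f (volume.restrict (Ioo (0 : ℝ) 1)) :=
  (Lp.memLp f).integrable (by norm_num)

theorem IsTest.deriv_test {F : Type*} [NormedAddCommGroup F] [NormedSpace ℝ F] {φ : ℝ → F}
    (h : IsTest φ) : IsTest (deriv φ) :=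
  ⟨(contDiff_infty_iff_deriv.1 h.smooth).2, h.compact.deriv,
    (closure_minimal ((support_deriv_subset)) (isClosed_tsupport _)).trans h.supp⟩

theorem L2.integrable_mul (f : L2) {φ : ℝ → ℂ} (hφ : IsTest φ) :
    Integrable (fun x => f x * φ x) (volume.restrict (Ioo (0 : ℝ) 1)) := by
  obtain ⟨C, hC⟩ := hφ.compact.exists_bound_of_continuous hφ.smooth.continuous
  exact Integrable.mul_bdd f.integrable hφ.smooth.continuous.aestronglyMeasurable
    (Filter.Eventually.of_forall hC)

theorem HasWeakDeriv.add {f₁ g₁ f₂ g₂ : L2} (h₁ : HasWeakDeriv f₁ g₁) (h₂ : HasWeakDeriv f₂ g₂) :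
    HasWeakDeriv (f₁ + f₂) (g₁ + g₂) := by
  intro φ hφ
  have e1 : ∫ x in Ioo (0 : ℝ) 1, (f₁ + f₂ : L2) x * deriv φ x
      = ∫ x in Ioo (0 : ℝ) 1, (f₁ x * deriv φ x + f₂ x * deriv φ x) := by
    refine integral_congr_ae ?_
    filter_upwards [Lp.coeFn_add f₁ f₂] with x hx
    rw [hx, Pi.add_apply, add_mul]
  have e2 : ∫ x in Ioo (0 : ℝ) 1, (g₁ + g₂ : L2) x * φ x
      = ∫ x in Ioo (0 : ℝ) 1, (g₁ x * φ x + g₂ x * φ x) := by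
    refine integral_congr_ae ?_
    filter_upwards [Lp.coeFn_add g₁ g₂] with x hx
    rw [hx, Pi.add_apply, add_mul]
  rw [e1, e2, integral_add (f₁.integrable_mul hφ.deriv_test) (f₂.integrable_mul hφ.deriv_test),
    integral_add (g₁.integrable_mul hφ) (g₂.integrable_mul hφ), h₁ φ hφ, h₂ φ hφ]
  ring

theorem HasWeakDeriv.smul {f g : L2} (c : ℂ) (h : HasWeakDeriv f g) :
    HasWeakDeriv (c • f) (c • g) := by
  intro φ hφ
  have e1 : ∫ x in Ioo (0 : ℝ) 1, (c • f : L2) x * deriv φ x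
      = ∫ x in Ioo (0 : ℝ) 1, c * (f x * deriv φ x) := by
    refine integral_congr_ae ?_
    filter_upwards [Lp.coeFn_smul c f] with x hx
    rw [hx, Pi.smul_apply, smul_eq_mul, mul_assoc]
  have e2 : ∫ x in Ioo (0 : ℝ) 1, (c • g : L2) x * φ x
      = ∫ x in Ioo (0 : ℝ) 1, c * (g x * φ x) := by
    refine integral_congr_ae ?_
    filter_upwards [Lp.coeFn_smul c g] with x hx
    rw [hx, Pi.smul_apply, smul_eq_mul, mul_assoc]
  rw [e1, e2, integral_const_mul, integral_const_mul, h φ hφ]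
  ring

theorem hasWeakDeriv_zero : HasWeakDeriv 0 0 := by
  simpa using HasWeakDeriv.smul (f := 0) (g := 0) 0 (fun φ _ => by
    have : ∀ ψ : ℝ → ℂ, ∫ x in Ioo (0 : ℝ) 1, (0 : L2) x * ψ x = 0 := fun ψ => by
      refine integral_eq_zero_of_ae ?_
      filter_upwards [Lp.coeFn_zero ℂ 2 (volume.restrict (Ioo (0 : ℝ) 1))] with x hx
      rw [hx]; simp
    rw [this, this, neg_zero])

theorem IsTest.ofReal {φ : ℝ → ℝ} (h : IsTest φ) : IsTest (fun x => (φ x : ℂ)) := by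
  obtain ⟨a, b, ha, hb, -, hz⟩ := h.exists_Icc
  exact IsTest.of_Icc (Complex.ofRealCLM.contDiff.comp h.smooth) ha hb
    fun x hx => by rw [hz x hx, Complex.ofReal_zero]

theorem IsTest.deriv_coe {φ : ℝ → ℝ} (h : IsTest φ) (x : ℝ) :
    deriv (fun x => (φ x : ℂ)) x = ((deriv φ x : ℝ) : ℂ) :=
  (((contDiff_infty_iff_deriv.1 h.smooth).1 x).hasDerivAt.ofReal_comp).deriv

theorem HasWeakDeriv.unique {f g₁ g₂ : L2} (h₁ : HasWeakDeriv f g₁) (h₂ : HasWeakDeriv f g₂) :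
    g₁ = g₂ := by
  have key := isOpen_Ioo.ae_eq_zero_of_integral_contDiff_smul_eq_zero (μ := volume)
    (f := fun x => g₁ x - g₂ x) (U := Ioo (0 : ℝ) 1)
    (IntegrableOn.locallyIntegrableOn (g₁.integrable.sub g₂.integrable)) ?_
  · refine Lp.ext ((ae_restrict_iff' measurableSet_Ioo).2 ?_)
    filter_upwards [key] with x hx hx'
    exact sub_eq_zero.1 (hx hx')
  · intro φ h1 h2 h3
    have hφ : IsTest φ := ⟨h1, h2, h3⟩
    rw [← setIntegral_eq_integral_of_forall_compl_eq_zero (s := Ioo (0 : ℝ) 1) fun x hx => by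
      rw [image_eq_zero_of_notMem_tsupport fun h' => hx (hφ.supp h'), zero_smul]]
    have e := neg_injective ((h₁ _ hφ.ofReal).symm.trans (h₂ _ hφ.ofReal))
    rw [← sub_eq_zero, ← integral_sub (g₁.integrable_mul hφ.ofReal)
      (g₂.integrable_mul hφ.ofReal)] at e
    rw [← e]
    refine integral_congr_ae (Filter.Eventually.of_forall fun x => ?_)
    simp only [Complex.real_smul]; ring

/-- The Sobolev space `H¹(0,1)`: the elements of `L²(0,1)` with a weak derivative in `L²(0,1)`. -/
def H1 : Submodule ℂ L2 where
  carrier := {f | ∃ g : L2, HasWeakDeriv f g}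
  add_mem' := fun ⟨g₁, h₁⟩ ⟨g₂, h₂⟩ => ⟨g₁ + g₂, h₁.add h₂⟩
  zero_mem' := ⟨0, hasWeakDeriv_zero⟩
  smul_mem' := fun c _ ⟨g, h⟩ => ⟨c • g, h.smul c⟩

/-- The (unique) weak derivative of an element of `H¹(0,1)`. -/
noncomputable def weakDeriv : H1 →ₗ[ℂ] L2 where
  toFun f := f.2.choose
  map_add' f₁ f₂ := (f₁ + f₂).2.choose_spec.unique (f₁.2.choose_spec.add f₂.2.choose_spec)
  map_smul' c f := (c • f).2.choose_spec.unique (f.2.choose_spec.smul c)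

theorem hasWeakDeriv_weakDeriv (f : H1) : HasWeakDeriv f (weakDeriv f) := f.2.choose_spec

/-- `H¹₀(0,1) = {f ∈ H¹(0,1) : f(0) = f(1) = 0}`, the boundary values being those of the
continuous representative of `f` on `[0,1]`. -/
def H10 : Submodule ℂ L2 where
  carrier := {f | f ∈ H1 ∧ ∃ F : ℝ → ℂ, ContinuousOn F (Icc 0 1) ∧
    f =ᵐ[volume.restrict (Ioo (0 : ℝ) 1)] F ∧ F 0 = 0 ∧ F 1 = 0}
  add_mem' := by
    rintro f₁ f₂ ⟨h₁, F₁, c₁, e₁, a₁, b₁⟩ ⟨h₂, F₂, c₂, e₂, a₂, b₂⟩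
    refine ⟨H1.add_mem h₁ h₂, F₁ + F₂, c₁.add c₂,
      (Lp.coeFn_add f₁ f₂).trans (e₁.add e₂), ?_, ?_⟩ <;> simp [*]
  zero_mem' := ⟨H1.zero_mem, 0, continuousOn_const, Lp.coeFn_zero _ _ _, rfl, rfl⟩
  smul_mem' := by
    rintro c f ⟨h, F, cF, e, a, b⟩
    refine ⟨H1.smul_mem c h, c • F, cF.const_smul c,
      (Lp.coeFn_smul c f).trans (e.const_smul c), ?_, ?_⟩ <;> simp [*]

theorem H10_le_H1 : H10 ≤ H1 := fun _ h => h.1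

theorem L2.re_memLp (f : L2) : MemLp (fun x => (f x).re) 2 (volume.restrict (Ioo (0 : ℝ) 1)) :=
  (Lp.memLp f).re

theorem L2.im_memLp (f : L2) : MemLp (fun x => (f x).im) 2 (volume.restrict (Ioo (0 : ℝ) 1)) :=
  (Lp.memLp f).im

/-- A function with a weak derivative is a constant plus the primitive of that derivative. -/
theorem HasWeakDeriv.exists_re_im {f g : L2} (h : HasWeakDeriv f g) :
    (∃ c : ℝ, ∀ᵐ x ∂(volume.restrict (Ioo (0 : ℝ) 1)),
      (f x).re = c + ∫ t in (0 : ℝ)..x, (g t).re) ∧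
    (∃ c : ℝ, ∀ᵐ x ∂(volume.restrict (Ioo (0 : ℝ) 1)),
      (f x).im = c + ∫ t in (0 : ℝ)..x, (g t).im) := by
  constructor
  · refine ae_eq_primitive f.integrable.re g.integrable.re fun φ hφ => ?_
    have e := congrArg Complex.re (h _ hφ.ofReal)
    simp only [hφ.deriv_coe] at e
    have i1 := f.integrable_mul hφ.deriv_test.ofReal
    have i2 := g.integrable_mul hφ.ofReal
    have t1 := integral_re i1
    have t2 := integral_re i2
    simp only [RCLike.re_to_complex, Complex.re_mul_ofReal] at t1 t2
    rw [Complex.neg_re, ← t1, ← t2] at e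
    simpa only [mul_comm] using e
  · refine ae_eq_primitive f.integrable.im g.integrable.im fun φ hφ => ?_
    have e := congrArg Complex.im (h _ hφ.ofReal)
    simp only [hφ.deriv_coe] at e
    have i1 := f.integrable_mul hφ.deriv_test.ofReal
    have i2 := g.integrable_mul hφ.ofReal
    have t1 := integral_im i1
    have t2 := integral_im i2
    simp only [RCLike.im_to_complex, Complex.im_mul_ofReal] at t1 t2
    rw [Complex.neg_im, ← t1, ← t2] at e
    simpa only [mul_comm] using e

theorem primitive_const_eq_zero {f g : ℝ → ℝ} {c : ℝ} (hg : IntegrableOn g (Ioo (0 : ℝ) 1))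
    {F : ℝ → ℝ} (hF : ContinuousOn F (Icc 0 1)) (h0 : F 0 = 0)
    (hfF : f =ᵐ[volume.restrict (Ioo (0 : ℝ) 1)] F)
    (h : ∀ᵐ x ∂(volume.restrict (Ioo (0 : ℝ) 1)), f x = c + ∫ t in (0 : ℝ)..x, g t) : c = 0 := by
  have hgI : IntervalIntegrable g volume 0 1 := by
    rw [intervalIntegrable_iff_integrableOn_Ioo_of_le zero_le_one]; exact hg
  have hc := (hgI.absolutelyContinuousOnInterval_intervalIntegral (c := 0) (by simp)).continuousOn
  rw [uIcc_of_le zero_le_one] at hc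
  have := Measure.eqOn_Icc_of_ae_eq volume (zero_ne_one' ℝ)
    (f := F) (g := fun x => c + ∫ t in (0 : ℝ)..x, g t) ?_ hF (continuousOn_const.add hc)
    (left_mem_Icc.2 zero_le_one)
  · simpa [h0] using this.symm
  · rw [← restrict_Ioo_eq_restrict_Icc]
    filter_upwards [h, hfF] with x hx hx'
    rw [← hx', hx]

/-- Hardy's inequality, qualitatively. -/
theorem memLp_div_of_mem_H10 {f : L2} (hf : f ∈ H10) :
    MemLp (fun x : ℝ => f x / (x : ℂ)) 2 (volume.restrict (Ioo (0 : ℝ) 1)) := by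
  obtain ⟨⟨g, hg⟩, F, hF, hfF, h0, -⟩ := hf
  obtain ⟨⟨c, hc⟩, ⟨d, hd⟩⟩ := hg.exists_re_im
  obtain rfl : c = 0 := primitive_const_eq_zero g.integrable.re
    (Complex.continuous_re.comp_continuousOn hF) (by simp [h0])
    (hfF.mono fun x hx => by simp [hx]) hc
  obtain rfl : d = 0 := primitive_const_eq_zero g.integrable.im
    (Complex.continuous_im.comp_continuousOn hF) (by simp [h0])
    (hfF.mono fun x hx => by simp [hx]) hd
  have m1 := memLp_primitive_div g.re_memLp f.re_memLp.1 (by simpa using hc)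
  have m2 := memLp_primitive_div g.im_memLp f.im_memLp.1 (by simpa using hd)
  have := m1.ofReal (K := ℂ) |>.add ((m2.ofReal (K := ℂ)).const_mul Complex.I)
  refine this.congr_norm ?_ (Filter.Eventually.of_forall fun x => ?_)
  · exact ((Lp.aestronglyMeasurable f).aemeasurable.div
      (by fun_prop)).aestronglyMeasurable
  · congr 1
    simp only [Pi.add_apply, RCLike.ofReal_eq_complex_ofReal, Complex.ofReal_div]
    conv_rhs => rw [← Complex.re_add_im (f x)]
    ring

/-- The map `f ↦ f / x` from `H¹₀(0,1)` to `L²(0,1)`. -/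
noncomputable def divX : H10 →ₗ[ℂ] L2 where
  toFun f := (memLp_div_of_mem_H10 f.2).toLp _
  map_add' f₁ f₂ := by
    rw [← MemLp.toLp_add, MemLp.toLp_eq_toLp_iff]
    filter_upwards [Lp.coeFn_add (f₁ : L2) f₂] with x hx
    simp only [Submodule.coe_add, hx, Pi.add_apply, add_div]
  map_smul' c f := by
    rw [RingHom.id_apply, ← MemLp.toLp_const_smul, MemLp.toLp_eq_toLp_iff]
    filter_upwards [Lp.coeFn_smul c (f : L2)] with x hx
    simp only [Submodule.coe_smul, hx, Pi.smul_apply, smul_eq_mul, mul_div_assoc]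

/-- The operator `A` with domain `H¹₀(0,1)` and `(A f)(x) = i f'(x) + i (γ / x) f(x)`. -/
noncomputable def A (γ : ℝ) : L2 →ₗ.[ℂ] L2 where
  domain := H10
  toFun := Complex.I • (weakDeriv ∘ₗ Submodule.inclusion H10_le_H1) +
    (Complex.I * (γ : ℂ)) • divX

/-- `A` acts as announced: `A f = i f' + i (γ / x) f` almost everywhere. -/
theorem A_apply_ae (γ : ℝ) (f : H10) {g : L2} (hg : HasWeakDeriv f g) :
    A γ f =ᵐ[volume.restrict (Ioo (0 : ℝ) 1)]
      fun x => Complex.I * g x + Complex.I * ((γ : ℂ) / (x : ℂ)) * (f : L2) x := by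
  have e1 : weakDeriv (Submodule.inclusion H10_le_H1 f) = g :=
    (hasWeakDeriv_weakDeriv (Submodule.inclusion H10_le_H1 f)).unique hg
  have e2 : A γ f = Complex.I • g + (Complex.I * (γ : ℂ)) • divX f := by rw [← e1]; rfl
  rw [e2]
  filter_upwards [Lp.coeFn_add (Complex.I • g) ((Complex.I * (γ : ℂ)) • divX f),
    Lp.coeFn_smul Complex.I g, Lp.coeFn_smul (Complex.I * (γ : ℂ)) (divX f),
    (memLp_div_of_mem_H10 f.2).coeFn_toLp] with x h1 h2 h3 h4
  rw [h1, Pi.add_apply, h2, h3, Pi.smul_apply, Pi.smul_apply]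
  have h5 : divX f x = (f : L2) x / (x : ℂ) := h4
  rw [h5, smul_eq_mul, smul_eq_mul]
  ring

/-- `C_c^∞(0,1)` as a subspace of `L²(0,1)`. -/
def testSpace : Submodule ℂ L2 where
  carrier := {f | ∃ φ : ℝ → ℂ, IsTest φ ∧ f =ᵐ[volume.restrict (Ioo (0 : ℝ) 1)] φ}
  add_mem' := by
    rintro f₁ f₂ ⟨φ₁, h₁, e₁⟩ ⟨φ₂, h₂, e₂⟩
    exact ⟨φ₁ + φ₂, ⟨h₁.smooth.add h₂.smooth, h₁.compact.add h₂.compact,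
      (tsupport_add _ _).trans (union_subset h₁.supp h₂.supp)⟩,
      (Lp.coeFn_add f₁ f₂).trans (e₁.add e₂)⟩
  zero_mem' := ⟨0, ⟨contDiff_const, HasCompactSupport.zero, by simp [tsupport]⟩,
    Lp.coeFn_zero _ _ _⟩
  smul_mem' := by
    rintro c f ⟨φ, h, e⟩
    exact ⟨c • φ, ⟨h.smooth.const_smul c, h.compact.smul_left (f := fun _ => c),
      (tsupport_smul_subset_right (fun _ => c) φ).trans h.supp⟩,
      (Lp.coeFn_smul c f).trans (e.const_smul c)⟩

theorem testSpace_le_H10 : testSpace ≤ H10 := by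
  rintro f ⟨φ, hφ, e⟩
  have hz : ∀ {ψ : ℝ → ℂ}, IsTest ψ → ∀ x, x ∉ Ioo (0 : ℝ) 1 → ψ x = 0 := fun hψ x hx =>
    image_eq_zero_of_notMem_tsupport fun h' => hx (hψ.supp h')
  have hm : MemLp (deriv φ) 2 (volume.restrict (Ioo (0 : ℝ) 1)) :=
    (hφ.deriv_test.smooth.continuous.memLp_of_hasCompactSupport hφ.deriv_test.compact).restrict _
  refine ⟨⟨hm.toLp _, fun ψ hψ => ?_⟩, φ, hφ.smooth.continuous.continuousOn, e,
    hz hφ 0 (by simp), hz hφ 1 (by simp)⟩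
  have e1 : ∫ x in Ioo (0 : ℝ) 1, f x * deriv ψ x = ∫ x, φ x * deriv ψ x := by
    refine (integral_congr_ae (e.mono fun x hx => ?_)).trans
      (setIntegral_eq_integral_of_forall_compl_eq_zero (s := Ioo (0 : ℝ) 1)
        (f := fun x => φ x * deriv ψ x) fun x hx => by simp only [hz hφ x hx, zero_mul])
    simp only [hx]
  have e2 : ∫ x in Ioo (0 : ℝ) 1, hm.toLp _ x * ψ x = ∫ x, deriv φ x * ψ x := by
    refine (integral_congr_ae (hm.coeFn_toLp.mono fun x hx => ?_)).trans
      (setIntegral_eq_integral_of_forall_compl_eq_zero (s := Ioo (0 : ℝ) 1)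
        (f := fun x => deriv φ x * ψ x) fun x hx => by simp only [hz hψ x hx, mul_zero])
    simp only [hx]
  rw [e1, e2]
  have cd : ∀ {ψ : ℝ → ℂ}, IsTest ψ → ∀ x, HasDerivAt ψ (deriv ψ x) x := fun hψ x =>
    ((contDiff_infty_iff_deriv.1 hψ.smooth).1 x).hasDerivAt
  refine integral_mul_deriv_eq_deriv_mul_of_integrable (fun x _ => cd hφ x) (fun x _ => cd hψ x)
    ?_ ?_ ?_
  · exact (hφ.smooth.continuous.mul hψ.deriv_test.smooth.continuous).integrable_of_hasCompactSupport
      hφ.compact.mul_right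
  · exact (hφ.deriv_test.smooth.continuous.mul hψ.smooth.continuous).integrable_of_hasCompactSupport
      hψ.compact.mul_left
  · exact (hφ.smooth.continuous.mul hψ.smooth.continuous).integrable_of_hasCompactSupport
      hψ.compact.mul_left

/-- `A₀`, the restriction of `A` to `C_c^∞(0,1)`. -/
noncomputable def A₀ (γ : ℝ) : L2 →ₗ.[ℂ] L2 := (A γ).domRestrict testSpace

theorem A₀_domain (γ : ℝ) : (A₀ γ).domain = testSpace := inf_eq_left.2 testSpace_le_H10

theorem memLp_sqrt_mul (γ : ℝ) (f : L2) :
    MemLp (fun x : ℝ => (√(x / γ) : ℂ) * f x) 2 (volume.restrict (Ioo (0 : ℝ) 1)) := by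
  refine (Lp.memLp f).of_le_mul (c := √(1 / |γ|)) ?_ ?_
  · exact AEStronglyMeasurable.mul (by fun_prop) (Lp.aestronglyMeasurable f)
  · filter_upwards [ae_restrict_mem measurableSet_Ioo] with x hx
    rw [norm_mul, Complex.norm_real, Real.norm_of_nonneg (Real.sqrt_nonneg _)]
    refine mul_le_mul_of_nonneg_right (Real.sqrt_le_sqrt ?_) (norm_nonneg _)
    refine (le_abs_self _).trans ?_
    rw [abs_div, abs_of_pos hx.1]
    exact div_le_div_of_nonneg_right hx.2.le (abs_nonneg γ)

/-- The operator `V^{-1/2}`, multiplication by `√(x / γ)`, on `L²(0,1)`, where the imaginary part `V` of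
`A₀` is the maximal multiplication operator by `γ / x`. -/
noncomputable def invSqrtV (γ : ℝ) : L2 →ₗ[ℂ] L2 where
  toFun f := (memLp_sqrt_mul γ f).toLp _
  map_add' f₁ f₂ := by
    rw [← MemLp.toLp_add, MemLp.toLp_eq_toLp_iff]
    filter_upwards [Lp.coeFn_add f₁ f₂] with x hx
    simp only [hx, Pi.add_apply, mul_add]
  map_smul' c f := by
    rw [RingHom.id_apply, ← MemLp.toLp_const_smul, MemLp.toLp_eq_toLp_iff]
    filter_upwards [Lp.coeFn_smul c f] with x hx
    simp only [hx, Pi.smul_apply, smul_eq_mul, mul_left_comm]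

/-- The operator `W = A₀ V^{-1/2}` on the domain `{g : V^{-1/2} g ∈ D(A₀)} = ran(V^{1/2} ↾ D(A₀))`. -/
noncomputable def W (γ : ℝ) : L2 →ₗ.[ℂ] L2 where
  domain := (A₀ γ).domain.comap (invSqrtV γ)
  toFun := (A₀ γ).toFun ∘ₗ (invSqrtV γ).restrict (p := (A₀ γ).domain.comap (invSqrtV γ))
    (q := (A₀ γ).domain) fun _ h => h

/-- The adjoint `W*` of `W`. -/
noncomputable def Wstar (γ : ℝ) : L2 →ₗ.[ℂ] L2 := (W γ).adjoint

/-- The inequality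
`Im ⟨v, ℓ⟩ ≥ (1/4) ∫₀¹ |√(x/γ) ℓ - i (√(x/γ) v)' + i (2γ+1)/(2 √(γ x)) v|² dx`,
where `u` is the weak derivative `(√(x/γ) v)'`. It is only used for `v` in the domain of `W*`, where
this weak derivative exists and the integrand is integrable. -/
def BoundaryCondition (γ : ℝ) (v ℓ : L2) : Prop :=
  ∃ u : L2, HasWeakDeriv (invSqrtV γ v) u ∧
    (1 / 4 : ℝ) * ∫ x in Ioo (0 : ℝ) 1,
      ‖((√(x / γ) : ℝ) : ℂ) * ℓ x - Complex.I * u x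
        + Complex.I * (((2 * γ + 1) / (2 * √(γ * x)) : ℝ) : ℂ) * v x‖ ^ 2
      ≤ (inner ℂ v ℓ).im

/-- The operator `A_{v,ℓ}` with domain `H¹₀(0,1) ∔ span{v}` and `f + λ v ↦ A f + λ ℓ`. -/
noncomputable def Aext (γ : ℝ) (v ℓ : L2) (hv : v ∉ H10) : L2 →ₗ.[ℂ] L2 :=
  (A γ).supSpanSingleton v ℓ hv

theorem Aext_apply (γ : ℝ) (v ℓ : L2) (hv : v ∉ H10) (f : H10) (c : ℂ)
    (h : (f : L2) + c • v ∈ (Aext γ v ℓ hv).domain) :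
    Aext γ v ℓ hv ⟨(f : L2) + c • v, h⟩ = A γ f + c • ℓ :=
  LinearPMap.supSpanSingleton_apply_mk (A γ) v ℓ hv f f.2 c

section Dissipative

variable {E : Type*} [NormedAddCommGroup E] [InnerProductSpace ℂ E]

/-- A densely defined operator `T` is dissipative if `Im ⟨f, T f⟩ ≥ 0` for all `f ∈ D(T)`. -/
def IsDissipative (T : E →ₗ.[ℂ] E) : Prop :=
  Dense (T.domain : Set E) ∧ ∀ f : T.domain, 0 ≤ (inner ℂ (f : E) (T f)).im

/-- A dissipative operator without non-trivial dissipative operator extension. -/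
def IsMaximallyDissipative (T : E →ₗ.[ℂ] E) : Prop :=
  IsDissipative T ∧ ∀ S : E →ₗ.[ℂ] E, IsDissipative S → T ≤ S → S = T

end Dissipative

end SingularFirstOrder

namespace SingularFirstOrder

/-! Write V for multiplication by γ/x. On H¹₀ integration by parts gives Re⟨f, f'⟩ = 0, hence Im⟨f,
Af⟩ = ‖V^{1/2}f‖² (`im_inner_A`). For a pair (v, ℓ) the form Im⟨f + cv, Af + cℓ⟩ is therefore
‖V^{1/2}f‖² + Im(c̄(⟨v, Af⟩ − ⟨V^{-1/2}ℓ, V^{1/2}f⟩)) + |c|² Im⟨v, ℓ⟩ (`im_inner_add_smul`). If it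
is nonnegative, rescaling f bounds ⟨v, Af⟩ by a multiple of ‖V^{1/2}f‖; since Af = W V^{1/2}f on
test functions, this means v ∈ D(W*). Then ⟨v, Af⟩ = ⟨W*v, V^{1/2}f⟩, and because the vectors
V^{1/2}f are dense in L², completing the square turns nonnegativity into Im⟨v, ℓ⟩ ≥ ¼‖V^{-1/2}ℓ −
W*v‖². The two directions are `mem_Wstar_and_boundaryCondition` and `im_inner_nonneg`.

The adjoint is found by solving first-order equations. If √x v = w + c x^{γ+1/2}, integration by
parts gives W*v = (i/√γ)(w' − (γ+1/2)w/x); the term in c drops out because x^γ is orthogonal to ran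
A (`IsDecomp.inner_A`). Conversely, given s = W*v, a dual Hardy inequality, valid since γ + 1/2 >
1/2, yields w ∈ H¹₀ with this right-hand side equal to s. Then v − w/√x annihilates ran A, so it is
a multiple of x^γ (`exists_isDecomp`). Rewriting W*v in terms of v gives the integrand of the
boundary condition (`IsDecomp.exists_weakDeriv`).

Maximality is a dimension count. The range of A + i contains the orthogonal complement of the single
function x^γ e^x, while B + i is injective for every dissipative B, so a dissipative extension of A
adds at most one dimension to H¹₀ (`exists_sub_smul_mem_H10`). Hence every proper dissipative
extension is some A_{v,ℓ} and is automatically maximal. A itself is not maximal, since v = x^γ, ℓ =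
0 satisfies the boundary condition as 0 ≤ 0. -/

/-! ### Multiplying and integrating against test functions -/

/-- The factor q may be singular at 0 and 1: off the support of φ the product vanishes locally, and
on the support q is smooth. -/
theorem IsTest.contDiffOn_mul {q φ : ℝ → ℂ} (hφ : IsTest φ)
    (hq : ContDiffOn ℝ ∞ q (Ioo (0 : ℝ) 1)) : IsTest (fun x => q x * φ x) := by
  obtain ⟨a, b, ha, hb, -, hz⟩ := hφ.exists_Icc
  refine IsTest.of_Icc (contDiff_iff_contDiffAt.2 fun x => ?_) ha hb
    fun x hx => by rw [hz x hx, mul_zero]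
  by_cases hx : x ∈ tsupport φ
  · exact (hq.contDiffAt (isOpen_Ioo.mem_nhds (hφ.supp hx))).mul hφ.smooth.contDiffAt
  · refine (contDiffAt_const (c := (0 : ℂ))).congr_of_eventuallyEq ?_
    filter_upwards [notMem_tsupport_iff_eventuallyEq.1 hx] with y hy
    rw [hy, Pi.zero_apply, mul_zero]

theorem integrableOn_mul_test {F φ : ℝ → ℂ} (hF : LocallyIntegrableOn F (Ioo (0 : ℝ) 1))
    (hφ : IsTest φ) : IntegrableOn (fun x => F x * φ x) (Ioo (0 : ℝ) 1) := by
  have h1 : IntegrableOn (fun x => F x * φ x) (tsupport φ) :=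
    (hF.integrableOn_compact_subset hφ.supp hφ.compact).mul_continuousOn
      hφ.smooth.continuous.continuousOn hφ.compact
  have h2 : Function.support (fun x => F x * φ x) ⊆ tsupport φ := fun x hx =>
    subset_tsupport _ (right_ne_zero_of_mul hx)
  exact ((integrableOn_iff_integrable_of_support_subset h2).1 h1).integrableOn

theorem integral_test_deriv {φ : ℝ → ℂ} (hφ : IsTest φ) {a b : ℝ} (hab : a ≤ b) (ha : φ a = 0)
    (hb : φ b = 0) : ∫ x in Ioo a b, deriv φ x = 0 := by
  rw [← integral_Ioc_eq_integral_Ioo, ← intervalIntegral.integral_of_le hab,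
    intervalIntegral.integral_deriv_eq_sub
      (fun x _ => (contDiff_infty_iff_deriv.1 hφ.smooth).1 x)
      (hφ.deriv_test.smooth.continuous.intervalIntegrable _ _), ha, hb, sub_zero]

/-! ### Distributional derivatives of functions that are only locally integrable -/

/-- `F` is locally integrable on `(0,1)` with locally integrable distributional derivative `G`. -/
structure HasLocalWeakDeriv (F G : ℝ → ℂ) : Prop where
  locInt : LocallyIntegrableOn F (Ioo (0 : ℝ) 1)
  locInt' : LocallyIntegrableOn G (Ioo (0 : ℝ) 1)
  integral_mul_deriv : ∀ φ : ℝ → ℂ, IsTest φ →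
    ∫ x in Ioo (0 : ℝ) 1, F x * deriv φ x = -∫ x in Ioo (0 : ℝ) 1, G x * φ x

theorem L2.locallyIntegrableOn (f : L2) : LocallyIntegrableOn f (Ioo (0 : ℝ) 1) :=
  IntegrableOn.locallyIntegrableOn f.integrable

theorem hasLocalWeakDeriv_iff {f g : L2} : HasLocalWeakDeriv f g ↔ HasWeakDeriv f g :=
  ⟨fun h => h.integral_mul_deriv, fun h => ⟨f.locallyIntegrableOn, g.locallyIntegrableOn, h⟩⟩

theorem locallyIntegrableOn_congr_ae {F F' : ℝ → ℂ}
    (h : LocallyIntegrableOn F (Ioo (0 : ℝ) 1))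
    (e : F =ᵐ[volume.restrict (Ioo (0 : ℝ) 1)] F') : LocallyIntegrableOn F' (Ioo (0 : ℝ) 1) := by
  rw [locallyIntegrableOn_iff isOpen_Ioo.isLocallyClosed] at h ⊢
  exact fun K hK hc => (h K hK hc).congr (ae_restrict_of_ae_restrict_of_subset hK e)

namespace HasLocalWeakDeriv

variable {F G F' G' : ℝ → ℂ}

theorem congr (h : HasLocalWeakDeriv F G) (e : F =ᵐ[volume.restrict (Ioo (0 : ℝ) 1)] F')
    (e' : G =ᵐ[volume.restrict (Ioo (0 : ℝ) 1)] G') : HasLocalWeakDeriv F' G' := by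
  refine ⟨locallyIntegrableOn_congr_ae h.locInt e, locallyIntegrableOn_congr_ae h.locInt' e',
    fun φ hφ => ?_⟩
  rw [← integral_congr_ae (e.mono fun x hx => by simp only [hx] :
      (fun x => F x * deriv φ x) =ᵐ[volume.restrict (Ioo (0 : ℝ) 1)] fun x => F' x * deriv φ x),
    ← integral_congr_ae (e'.mono fun x hx => by simp only [hx] :
      (fun x => G x * φ x) =ᵐ[volume.restrict (Ioo (0 : ℝ) 1)] fun x => G' x * φ x)]
  exact h.integral_mul_deriv φ hφ

theorem add (h : HasLocalWeakDeriv F G) (h' : HasLocalWeakDeriv F' G') :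
    HasLocalWeakDeriv (fun x => F x + F' x) (fun x => G x + G' x) := by
  refine ⟨h.locInt.add h'.locInt, h.locInt'.add h'.locInt', fun φ hφ => ?_⟩
  simp only [add_mul]
  rw [integral_add (integrableOn_mul_test h.locInt hφ.deriv_test)
      (integrableOn_mul_test h'.locInt hφ.deriv_test),
    integral_add (integrableOn_mul_test h.locInt' hφ) (integrableOn_mul_test h'.locInt' hφ),
    h.integral_mul_deriv φ hφ, h'.integral_mul_deriv φ hφ]
  ring

theorem mul_locallyIntegrableOn {q : ℝ → ℂ} (hq : ContinuousOn q (Ioo (0 : ℝ) 1))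
    (hF : LocallyIntegrableOn F (Ioo (0 : ℝ) 1)) :
    LocallyIntegrableOn (fun x => q x * F x) (Ioo (0 : ℝ) 1) :=
  hF.continuousOn_mul hq isOpen_Ioo.isLocallyClosed

/-- The product rule. -/
theorem mul {q q' : ℝ → ℂ} (h : HasLocalWeakDeriv F G)
    (hq : ContDiffOn ℝ ∞ q (Ioo (0 : ℝ) 1))
    (hq' : ∀ x ∈ Ioo (0 : ℝ) 1, HasDerivAt q (q' x) x) :
    HasLocalWeakDeriv (fun x => q x * F x) (fun x => q' x * F x + q x * G x) := by
  have hc : ContinuousOn q' (Ioo (0 : ℝ) 1) :=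
    (hq.continuousOn_deriv_of_isOpen isOpen_Ioo (by simp)).congr
      fun x hx => (hq' x hx).deriv.symm
  have i1 := mul_locallyIntegrableOn hc h.locInt
  have i2 := mul_locallyIntegrableOn hq.continuousOn h.locInt'
  have i3 := mul_locallyIntegrableOn hq.continuousOn h.locInt
  refine ⟨i3, i1.add i2, fun φ hφ => ?_⟩
  have key := h.integral_mul_deriv _ (hφ.contDiffOn_mul hq)
  have e : ∫ x in Ioo (0 : ℝ) 1, F x * deriv (fun x => q x * φ x) x
      = ∫ x in Ioo (0 : ℝ) 1, (q' x * F x * φ x + q x * F x * deriv φ x) := by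
    refine setIntegral_congr_fun measurableSet_Ioo fun x hx => ?_
    have := ((hq' x hx).mul ((contDiff_infty_iff_deriv.1 hφ.smooth).1 x).hasDerivAt).deriv
    rw [show (fun x => q x * φ x) = q * φ from rfl, this]
    ring
  rw [e, integral_add (integrableOn_mul_test i1 hφ) (integrableOn_mul_test i3 hφ.deriv_test)]
    at key
  simp only [add_mul]
  rw [integral_add (integrableOn_mul_test i1 hφ) (integrableOn_mul_test i2 hφ)]
  have e2 : ∫ x in Ioo (0 : ℝ) 1, G x * (q x * φ x) = ∫ x in Ioo (0 : ℝ) 1, q x * G x * φ x := by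
    congr 1; ext x; ring
  rw [e2] at key
  linear_combination key

/-- Fubini on the triangle t < x. Since p is merely integrable, the inner integral of φ' over (t, b)
replaces differentiation of the primitive. -/
theorem integral_primitive_mul_deriv {p φ : ℝ → ℂ} {a b : ℝ} (hp : IntegrableOn p (Ioo a b))
    (hφ : IsTest φ) (hb : φ b = 0) :
    ∫ x in Ioo a b, (∫ t in Ioo a x, p t) * deriv φ x = -∫ x in Ioo a b, p x * φ x := by
  have hi : Integrable (fun z : ℝ × ℝ => {z : ℝ × ℝ | z.2 < z.1}.indicator
      (fun z => p z.2 * deriv φ z.1) z)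
      ((volume.restrict (Ioo a b)).prod (volume.restrict (Ioo a b))) := by
    refine Integrable.indicator ?_ (measurableSet_lt measurable_snd measurable_fst)
    have hd : IntegrableOn (deriv φ) (Ioo a b) :=
      (hφ.deriv_test.smooth.continuous.integrable_of_hasCompactSupport
        hφ.deriv_test.compact).integrableOn
    simpa only [mul_comm] using hd.mul_prod hp
  calc ∫ x in Ioo a b, (∫ t in Ioo a x, p t) * deriv φ x
      = ∫ x in Ioo a b, ∫ t in Ioo a b, {z : ℝ × ℝ | z.2 < z.1}.indicator
          (fun z => p z.2 * deriv φ z.1) (x, t) := by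
        refine setIntegral_congr_fun measurableSet_Ioo fun x hx => ?_
        have e : ∀ t, {z : ℝ × ℝ | z.2 < z.1}.indicator (fun z => p z.2 * deriv φ z.1) (x, t)
            = (Iio x).indicator (fun t => p t * deriv φ x) t := fun t => by
          simp only [indicator, mem_ofPred_eq, mem_Iio]
        simp only [e]
        rw [setIntegral_indicator measurableSet_Iio, Ioo_inter_Iio, min_eq_right hx.2.le,
          integral_mul_const]
    _ = ∫ t in Ioo a b, ∫ x in Ioo a b, {z : ℝ × ℝ | z.2 < z.1}.indicator
          (fun z => p z.2 * deriv φ z.1) (x, t) := integral_integral_swap hi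
    _ = ∫ t in Ioo a b, -(p t * φ t) := by
        refine setIntegral_congr_fun measurableSet_Ioo fun t ht => ?_
        have e : ∀ x, {z : ℝ × ℝ | z.2 < z.1}.indicator (fun z => p z.2 * deriv φ z.1) (x, t)
            = (Ioi t).indicator (fun x => p t * deriv φ x) x := fun x => by
          simp only [indicator, mem_ofPred_eq, mem_Ioi]
        simp only [e]
        rw [setIntegral_indicator measurableSet_Ioi, Ioo_inter_Ioi, sup_eq_right.2 ht.1.le,
          integral_const_mul, ← integral_Ioc_eq_integral_Ioo,
          ← intervalIntegral.integral_of_le ht.2.le,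
          intervalIntegral.integral_deriv_eq_sub
            (fun x _ => (contDiff_infty_iff_deriv.1 hφ.smooth).1 x)
            (hφ.deriv_test.smooth.continuous.intervalIntegrable _ _), hb]
        ring
    _ = _ := integral_neg _

theorem integral_Ioo_eq_of_test {H φ : ℝ → ℂ} {a b : ℝ} (ha : 0 < a) (hb : b < 1)
    (hz : ∀ x, x ∉ Ioo a b → φ x = 0) :
    ∫ x in Ioo (0 : ℝ) 1, H x * φ x = ∫ x in Ioo a b, H x * φ x :=
  (setIntegral_eq_of_subset_of_forall_sdiff_eq_zero measurableSet_Ioo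
    (Ioo_subset_Ioo ha.le hb.le) fun x hx => by rw [hz x hx.2, mul_zero])

/-- A primitive on `(0,1)` of a locally integrable function has that function as its derivative. -/
theorem of_primitive {P p : ℝ → ℂ} (hp : LocallyIntegrableOn p (Ioo (0 : ℝ) 1))
    (hc : ContinuousOn P (Ioo (0 : ℝ) 1))
    (hP : ∀ x ∈ Ioo (0 : ℝ) 1, ∀ y ∈ Ioo (0 : ℝ) 1, x ≤ y → P y - P x = ∫ t in x..y, p t) :
    HasLocalWeakDeriv P p := by
  refine ⟨hc.locallyIntegrableOn measurableSet_Ioo, hp, fun φ hφ => ?_⟩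
  obtain ⟨a', b', ha', hb', hab', hz'⟩ := hφ.exists_Icc
  -- Enlarging the support interval slightly inside (0,1) makes φ vanish at a and b while p stays
  -- integrable on [a, b].
  obtain ⟨a, ha, haa⟩ := exists_between ha'
  obtain ⟨b, hbb, hb⟩ := exists_between hb'
  have hab : a < b := haa.trans_le (hab'.trans hbb.le)
  have hz : ∀ x, x ∉ Icc a' b' → deriv φ x = 0 := fun x hx => by
    have : φ =ᶠ[nhds x] fun _ => 0 := by
      filter_upwards [isClosed_Icc.isOpen_compl.mem_nhds hx] with y hy using hz' y hy
    rw [this.deriv_eq, deriv_const]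
  have hsub : ∀ x, x ∉ Ioo a b → x ∉ Icc a' b' := fun x hx hx' =>
    hx ⟨haa.trans_le hx'.1, hx'.2.trans_lt hbb⟩
  rw [integral_Ioo_eq_of_test ha hb fun x hx => hz x (hsub x hx),
    integral_Ioo_eq_of_test ha hb fun x hx => hz' x (hsub x hx)]
  have hI : IntegrableOn p (Ioo a b) :=
    (hp.integrableOn_compact_subset (Icc_subset_Ioo ha hb) isCompact_Icc).mono_set
      Ioo_subset_Icc_self
  have hPI : IntegrableOn (fun x => (P x - P a) * deriv φ x) (Ioo a b) :=
    ((((hc.mono (Icc_subset_Ioo ha hb)).sub continuousOn_const).mul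
      hφ.deriv_test.smooth.continuous.continuousOn).integrableOn_Icc).mono_set Ioo_subset_Icc_self
  have hdI : IntegrableOn (fun x => P a * deriv φ x) (Ioo a b) :=
    ((hφ.deriv_test.smooth.continuous.integrable_of_hasCompactSupport
        hφ.deriv_test.compact).integrableOn).const_mul _
  have z1 : φ a = 0 := hz' a (hsub a (by simp))
  have z2 : φ b = 0 := hz' b (hsub b (by simp))
  rw [← integral_primitive_mul_deriv hI hφ z2]
  calc ∫ x in Ioo a b, P x * deriv φ x
      = ∫ x in Ioo a b, ((P x - P a) * deriv φ x + P a * deriv φ x) := by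
        congr 1; ext x; ring
    _ = ∫ x in Ioo a b, (P x - P a) * deriv φ x := by
        rw [integral_add hPI hdI, integral_const_mul, integral_test_deriv hφ hab.le z1 z2,
          mul_zero, add_zero]
    _ = _ := by
        refine setIntegral_congr_fun measurableSet_Ioo fun x hx => ?_
        rw [hP a ⟨ha, hab.trans hb⟩ x ⟨ha.trans hx.1, hx.2.trans hb⟩ hx.1.le,
          intervalIntegral.integral_of_le hx.1.le, integral_Ioc_eq_integral_Ioo]

/-- The product rule applied to the constant function 1, itself the primitive of 0. -/
theorem of_hasDerivAt {q q' : ℝ → ℂ} (hq : ContDiffOn ℝ ∞ q (Ioo (0 : ℝ) 1))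
    (hq' : ∀ x ∈ Ioo (0 : ℝ) 1, HasDerivAt q (q' x) x) : HasLocalWeakDeriv q q' := by
  have h1 : HasLocalWeakDeriv (fun _ => 1) (fun _ => 0) :=
    of_primitive (continuousOn_const.locallyIntegrableOn measurableSet_Ioo) continuousOn_const
      (by simp)
  simpa using h1.mul hq hq'

end HasLocalWeakDeriv

/-! ### Membership in H¹₀ and the range of A + iκ -/

theorem weakDeriv_inclusion_eq {f : H10} {g : L2} (h : HasWeakDeriv f g) :
    weakDeriv (Submodule.inclusion H10_le_H1 f) = g :=
  (hasWeakDeriv_weakDeriv (Submodule.inclusion H10_le_H1 f)).unique h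

theorem coeFn_divX (f : H10) :
    divX f =ᵐ[volume.restrict (Ioo (0 : ℝ) 1)] fun x => (f : L2) x / (x : ℂ) :=
  (memLp_div_of_mem_H10 f.2).coeFn_toLp

/-- Hardy's inequality for the majorant ∫₀ˣ|u|, which dominates the solutions of the equation (A +
iκ)f = u. -/
theorem memLp_primitive_norm_div (u : L2) :
    MemLp (fun x : ℝ => (∫ t in (0 : ℝ)..x, ‖u t‖) / x) 2 (volume.restrict (Ioo (0 : ℝ) 1)) := by
  refine memLp_primitive_div (Lp.memLp u).norm ?_ (Filter.Eventually.of_forall fun _ => rfl)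
  have hI : IntervalIntegrable (fun t => ‖u t‖) volume 0 1 := by
    rw [intervalIntegrable_iff_integrableOn_Ioo_of_le zero_le_one]; exact u.integrable.norm
  have hc := (hI.absolutelyContinuousOnInterval_intervalIntegral (c := 0) (by simp)).continuousOn
  rw [uIcc_of_le zero_le_one] at hc
  exact (hc.mono Ioo_subset_Icc_self).aestronglyMeasurable measurableSet_Ioo

/-- A function vanishing at `0` and `1`, continuous on `[0,1]`, whose distributional derivative has the
form `q F / x + h` with `q` bounded and `F / x`, `h` square integrable, belongs to `H¹₀(0,1)`. -/
theorem exists_H10_of_hasLocalWeakDeriv {F : ℝ → ℂ} {q : ℝ → ℝ} {C : ℝ} {h : L2}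
    (hF : ContinuousOn F (Icc 0 1)) (h0 : F 0 = 0) (h1 : F 1 = 0)
    (hd : MemLp (fun x : ℝ => F x / (x : ℂ)) 2 (volume.restrict (Ioo (0 : ℝ) 1)))
    (hq : ContinuousOn q (Ioo 0 1)) (hC : ∀ x ∈ Ioo (0 : ℝ) 1, |q x| ≤ C)
    (hw : HasLocalWeakDeriv F fun x => (q x : ℂ) * (F x / (x : ℂ)) + h x) :
    ∃ f : H10, ((f : L2) =ᵐ[volume.restrict (Ioo (0 : ℝ) 1)] F) ∧
      weakDeriv (Submodule.inclusion H10_le_H1 f)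
        =ᵐ[volume.restrict (Ioo (0 : ℝ) 1)] fun x => (q x : ℂ) * divX f x + h x := by
  have hFm : MemLp F 2 (volume.restrict (Ioo (0 : ℝ) 1)) := by
    -- On (0,1) division by x only increases the modulus, so F/x ∈ L² forces F ∈ L².
    refine hd.mono ((hF.mono Ioo_subset_Icc_self).aestronglyMeasurable measurableSet_Ioo) ?_
    filter_upwards [ae_restrict_mem measurableSet_Ioo] with x hx
    rw [norm_div, Complex.norm_real, Real.norm_of_nonneg hx.1.le]
    exact le_div_self (norm_nonneg _) hx.1 hx.2.le
  have hgm : MemLp (fun x => (q x : ℂ) * (F x / (x : ℂ)) + h x) 2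
      (volume.restrict (Ioo (0 : ℝ) 1)) := by
    refine MemLp.add (f := fun x => (q x : ℂ) * (F x / (x : ℂ))) ?_ (Lp.memLp h)
    refine hd.of_le_mul (c := C) (AEStronglyMeasurable.mul ?_ hd.1) ?_
    · exact (Complex.continuous_ofReal.comp_continuousOn hq).aestronglyMeasurable measurableSet_Ioo
    · filter_upwards [ae_restrict_mem measurableSet_Ioo] with x hx
      rw [norm_mul, Complex.norm_real]
      exact mul_le_mul_of_nonneg_right (hC x hx) (norm_nonneg _)
  have hwd : HasWeakDeriv (hFm.toLp _) (hgm.toLp _) :=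
    hasLocalWeakDeriv_iff.1 (hw.congr hFm.coeFn_toLp.symm hgm.coeFn_toLp.symm)
  have hf : hFm.toLp _ ∈ H10 := ⟨⟨_, hwd⟩, F, hF, hFm.coeFn_toLp, h0, h1⟩
  refine ⟨⟨_, hf⟩, hFm.coeFn_toLp, ?_⟩
  rw [weakDeriv_inclusion_eq (f := ⟨_, hf⟩) hwd]
  filter_upwards [hgm.coeFn_toLp, coeFn_divX ⟨_, hf⟩, hFm.coeFn_toLp] with x h1 h2 h3
  rw [h1, h2, h3]

theorem tendsto_primitive_norm (u : L2) : Filter.Tendsto (fun x => ∫ t in (0 : ℝ)..x, ‖u t‖)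
    (nhdsWithin 0 (Icc 0 1)) (nhds 0) := by
  have hI : IntervalIntegrable (fun t => ‖u t‖) volume 0 1 := by
    rw [intervalIntegrable_iff_integrableOn_Ioo_of_le zero_le_one]; exact u.integrable.norm
  have hc := (hI.absolutelyContinuousOnInterval_intervalIntegral (c := 0) (by simp)).continuousOn
  rw [uIcc_of_le zero_le_one] at hc
  simpa [ContinuousWithinAt] using hc 0 (by simp)

theorem hasDerivAt_ofReal_rpow (r : ℝ) {x : ℝ} (hx : 0 < x) :
    HasDerivAt (fun x : ℝ => ((x ^ r : ℝ) : ℂ)) ((r * x ^ (r - 1) : ℝ) : ℂ) x :=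
  (Real.hasDerivAt_rpow_const (Or.inl hx.ne')).ofReal_comp

theorem contDiffOn_ofReal_rpow (r : ℝ) :
    ContDiffOn ℝ ∞ (fun x : ℝ => ((x ^ r : ℝ) : ℂ)) (Ioo 0 1) :=
  Complex.ofRealCLM.contDiff.comp_contDiffOn fun _ hx =>
    (Real.contDiffAt_rpow_const_of_ne hx.1.ne').contDiffWithinAt

/-- `A + iκ` maps onto the orthogonal complement of `x^γ e^{κx}`. -/
theorem exists_A_add_smul_eq {γ κ : ℝ} (hγ : 0 < γ) (hκ : 0 ≤ κ) (u : L2)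
    (hu : ∫ t in Ioo (0 : ℝ) 1, ((t ^ γ * Real.exp (κ * t) : ℝ) : ℂ) * u t = 0) :
    ∃ f : H10, A γ f + (Complex.I * κ) • (f : L2) = u := by
  -- Integrating factor: if' + i(γ/x + κ)f = u is equivalent to (mf)' = −i m u, so f is 1/m times
  -- the primitive of −i m u from 0.
  set m : ℝ → ℝ := fun t => t ^ γ * Real.exp (κ * t) with hm
  have hmc : Continuous m := (Real.continuous_rpow_const hγ.le).mul (by fun_prop)
  have hmpos : ∀ x, 0 < x → 0 < m x := fun x hx => mul_pos (Real.rpow_pos_of_pos hx _) (Real.exp_pos _)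
  have hmono : ∀ x y, 0 ≤ x → x ≤ y → m x ≤ m y := fun x y hx hxy =>
    mul_le_mul (Real.rpow_le_rpow hx hxy hγ.le)
      (Real.exp_le_exp.2 (mul_le_mul_of_nonneg_left hxy hκ)) (Real.exp_pos _).le
      (Real.rpow_nonneg (hx.trans hxy) _)
  have hpI : IntegrableOn (fun t => (m t : ℂ) * (-Complex.I * u t)) (Ioo (0 : ℝ) 1) := by
    refine Integrable.bdd_mul (c := m 1) (u.integrable.const_mul _) (by fun_prop) ?_
    filter_upwards [ae_restrict_mem measurableSet_Ioo] with x hx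
    rw [Complex.norm_real, Real.norm_of_nonneg (hmpos x hx.1).le]
    exact hmono x 1 hx.1.le hx.2.le
  set p : ℝ → ℂ := fun t => (m t : ℂ) * (-Complex.I * u t) with hp
  have hpII : IntervalIntegrable p volume 0 1 := by
    rwa [intervalIntegrable_iff_integrableOn_Ioo_of_le zero_le_one]
  have hpIxy : ∀ x ∈ Icc (0 : ℝ) 1, ∀ y ∈ Icc (0 : ℝ) 1, IntervalIntegrable p volume x y :=
    fun x hx y hy => hpII.mono_set (uIcc_subset_uIcc (by simpa using hx) (by simpa using hy))
  set P : ℝ → ℂ := fun x => ∫ t in (0 : ℝ)..x, p t with hP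
  have hPc : ContinuousOn P (Icc 0 1) := by
    have := intervalIntegral.continuousOn_primitive_interval (f := p) (μ := volume) (a := 0) (b := 1)
      (by rw [uIcc_of_le zero_le_one, integrableOn_Icc_iff_integrableOn_Ioo]; exact hpI)
    rwa [uIcc_of_le zero_le_one] at this
  set F : ℝ → ℂ := fun x => ((m x)⁻¹ : ℝ) * P x with hF
  -- As γ and κ are nonnegative, m is increasing, so m(t)/m(x) ≤ 1 for t ≤ x and the weights
  -- disappear. The bound gives both continuity at 0 and F/x ∈ L².
  have hbound : ∀ x ∈ Icc (0 : ℝ) 1, ‖F x‖ ≤ ∫ t in (0 : ℝ)..x, ‖u t‖ := by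
    intro x hx
    rcases hx.1.eq_or_lt with rfl | hx0
    · simp [hF, hP]
    have e : F x = ∫ t in (0 : ℝ)..x, (((m x)⁻¹ : ℝ) : ℂ) * p t := by
      rw [intervalIntegral.integral_const_mul]
    rw [e]
    refine intervalIntegral.norm_integral_le_of_norm_le hx.1 ?_ ?_
    · refine Filter.Eventually.of_forall fun t ht => ?_
      have hpt : ‖p t‖ = ‖m t‖ * ‖u t‖ := by
        rw [norm_mul, Complex.norm_real, norm_mul (-Complex.I), norm_neg, Complex.norm_I, one_mul]
      rw [norm_mul, hpt, Complex.norm_real, ← mul_assoc]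
      refine mul_le_of_le_one_left (norm_nonneg _) ?_
      rw [Real.norm_of_nonneg (inv_nonneg.2 (hmpos x hx0).le), Real.norm_of_nonneg (hmpos t ht.1).le,
        inv_mul_le_one₀ (hmpos x hx0)]
      exact hmono t x ht.1.le ht.2
    · have : IntervalIntegrable (fun t => ‖u t‖) volume 0 1 := by
        rw [intervalIntegrable_iff_integrableOn_Ioo_of_le zero_le_one]; exact u.integrable.norm
      exact this.mono_set (uIcc_subset_uIcc (by simp) (by simpa using hx))
  have hF0 : F 0 = 0 := by simp [hF, hP]
  -- The orthogonality hypothesis is exactly the boundary condition at 1.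
  have hF1 : F 1 = 0 := by
    have : P 1 = -Complex.I * ∫ t in Ioo (0 : ℝ) 1, (m t : ℂ) * u t := by
      rw [hP, ← integral_const_mul]
      simp only
      rw [intervalIntegral.integral_of_le zero_le_one, integral_Ioc_eq_integral_Ioo]
      congr 1; ext t; rw [hp]; ring
    rw [hF]; simp only
    rw [this, hu, mul_zero, mul_zero]
  have hFc : ContinuousOn F (Icc 0 1) := by
    intro x hx
    rcases hx.1.eq_or_lt with rfl | hx0
    · rw [ContinuousWithinAt, hF0]
      refine squeeze_zero_norm' ?_ (tendsto_primitive_norm u)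
      filter_upwards [self_mem_nhdsWithin] with y hy using hbound y hy
    · refine ContinuousWithinAt.mul ?_ (hPc x hx)
      exact (Complex.continuous_ofReal.continuousAt.comp
        (hmc.continuousAt.inv₀ (hmpos x hx0).ne')).continuousWithinAt
  have hd : MemLp (fun x : ℝ => F x / (x : ℂ)) 2 (volume.restrict (Ioo (0 : ℝ) 1)) := by
    refine (memLp_primitive_norm_div u).mono ?_ ?_
    · exact (((hFc.mono Ioo_subset_Icc_self).aestronglyMeasurable
        measurableSet_Ioo).aemeasurable.div (by fun_prop)).aestronglyMeasurable
    · filter_upwards [ae_restrict_mem measurableSet_Ioo] with x hx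
      rw [norm_div, norm_div, Complex.norm_real]
      exact div_le_div_of_nonneg_right ((hbound x (Ioo_subset_Icc_self hx)).trans
        (Real.le_norm_self _)) (norm_nonneg _)
  have hPw : HasLocalWeakDeriv P p := by
    refine .of_primitive hpI.locallyIntegrableOn (hPc.mono Ioo_subset_Icc_self)
      fun x hx y hy hxy => ?_
    exact intervalIntegral.integral_interval_sub_left
      (hpIxy 0 (by simp) y (Ioo_subset_Icc_self hy)) (hpIxy 0 (by simp) x (Ioo_subset_Icc_self hx))
  have hmd : ∀ x ∈ Ioo (0 : ℝ) 1, HasDerivAt (fun x => (((m x)⁻¹ : ℝ) : ℂ))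
      ((-((γ / x + κ) * (m x)⁻¹) : ℝ) : ℂ) x := by
    intro x hx
    have h1 : HasDerivAt m ((γ / x + κ) * m x) x := by
      have := (Real.hasDerivAt_rpow_const (p := γ) (Or.inl hx.1.ne')).mul
        ((hasDerivAt_id x).const_mul κ).exp
      refine this.congr_deriv ?_
      simp only [hm, id, mul_one]
      rw [Real.rpow_sub_one hx.1.ne']
      field_simp
    refine (h1.inv (hmpos x hx.1).ne').ofReal_comp.congr_deriv ?_
    have := (hmpos x hx.1).ne'
    congr 1
    field_simp
  have hmsm : ContDiffOn ℝ ∞ (fun x => (((m x)⁻¹ : ℝ) : ℂ)) (Ioo 0 1) := by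
    refine Complex.ofRealCLM.contDiff.comp_contDiffOn (ContDiffOn.inv ?_ fun x hx => (hmpos x hx.1).ne')
    exact ContDiffOn.mul (fun x hx => (Real.contDiffAt_rpow_const_of_ne hx.1.ne').contDiffWithinAt)
      (by fun_prop)
  have hFw := hPw.mul hmsm hmd
  obtain ⟨f, hf, hfd⟩ := exists_H10_of_hasLocalWeakDeriv (h := -Complex.I • u)
    (q := fun x => -(γ + κ * x)) (C := γ + κ) hFc hF0 hF1 hd (by fun_prop) (fun x hx => by
      rw [abs_neg, abs_of_nonneg (add_nonneg hγ.le (mul_nonneg hκ hx.1.le))]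
      exact add_le_add le_rfl (mul_le_of_le_one_right hκ hx.2.le)) (by
      refine hFw.congr (Filter.EventuallyEq.refl _ _) ?_
      filter_upwards [ae_restrict_mem measurableSet_Ioo, Lp.coeFn_smul (-Complex.I) u] with x hx hx'
      have h1 : (m x : ℂ) ≠ 0 := Complex.ofReal_ne_zero.2 (hmpos x hx.1).ne'
      have h2 : (x : ℂ) ≠ 0 := Complex.ofReal_ne_zero.2 hx.1.ne'
      rw [hx']
      simp only [hF, hp, Pi.smul_apply, smul_eq_mul]
      push_cast
      field_simp)
  refine ⟨f, Lp.ext ?_⟩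
  have e := A_apply_ae γ f (hasWeakDeriv_weakDeriv (Submodule.inclusion H10_le_H1 f))
  filter_upwards [e, hfd, coeFn_divX f, Lp.coeFn_smul (-Complex.I) u,
    Lp.coeFn_add (A γ f) ((Complex.I * κ) • (f : L2)), Lp.coeFn_smul (Complex.I * κ) (f : L2),
    ae_restrict_mem measurableSet_Ioo] with x h1 h2 h3 h4 h5 h6 hx
  have hx0 : (x : ℂ) ≠ 0 := Complex.ofReal_ne_zero.2 hx.1.ne'
  rw [h5, Pi.add_apply, h1, h6, h2, h3, h4]
  simp only [Pi.smul_apply, smul_eq_mul]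
  push_cast
  field_simp
  linear_combination (-(x : ℂ) * u x) * Complex.I_mul_I

/-! ### The dual Hardy inequality and the equation w' = (β/x)w + h -/

theorem lintegral_ofReal_rpow_Ioo_le {r x : ℝ} (hr : r < -1) (hx : 0 < x) (hx1 : x < 1) :
    ∫⁻ t in Ioo x 1, ENNReal.ofReal (t ^ r) ≤ ENNReal.ofReal (x ^ (r + 1) / (-(r + 1))) := by
  have h0 : (0 : ℝ) ∉ uIcc x 1 := by
    rw [uIcc_of_le hx1.le]; exact fun h => absurd h.1 (not_le.2 hx)
  rw [← ofReal_integral_eq_lintegral_ofReal]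
  · rw [← integral_Ioc_eq_integral_Ioo, ← intervalIntegral.integral_of_le hx1.le,
      integral_rpow (Or.inr ⟨hr.ne, h0⟩), Real.one_rpow, ← neg_div_neg_eq]
    refine ENNReal.ofReal_le_ofReal (div_le_div_of_nonneg_right ?_ (by linarith))
    linarith
  · have := intervalIntegral.intervalIntegrable_rpow (μ := volume) (r := r) (Or.inr h0)
    rwa [intervalIntegrable_iff_integrableOn_Ioo_of_le hx1.le] at this
  · exact (ae_restrict_iff' measurableSet_Ioo).2 (Filter.Eventually.of_forall fun t ht =>
      Real.rpow_nonneg (hx.trans ht.1).le _)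

theorem lintegral_ofReal_rpow_Ioo_zero {r t : ℝ} (hr : -1 < r) (ht : 0 < t) :
    ∫⁻ x in Ioo 0 t, ENNReal.ofReal (x ^ r) = ENNReal.ofReal (t ^ (r + 1) / (r + 1)) := by
  rw [← ofReal_integral_eq_lintegral_ofReal]
  · rw [← integral_Ioc_eq_integral_Ioo, ← intervalIntegral.integral_of_le ht.le,
      integral_rpow (Or.inl hr), Real.zero_rpow (by linarith), sub_zero]
  · have := intervalIntegral.intervalIntegrable_rpow' (a := 0) (b := t) hr
    rwa [intervalIntegrable_iff_integrableOn_Ioo_of_le ht.le] at this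
  · exact (ae_restrict_iff' measurableSet_Ioo).2 (Filter.Eventually.of_forall fun t ht =>
      Real.rpow_nonneg ht.1.le _)

/-- Cauchy–Schwarz after splitting t^{-β}g as t^{-(β/2+1/4)} · t^{-(β/2-1/4)}g. The first square
t^{-β-1/2} integrates over (x, 1) to at most x^{1/2-β}/(β − 1/2), and the second leaves a weight
that can still be integrated in x after Tonelli. -/
theorem sq_lintegral_rpow_mul_le {β : ℝ} (hβ : 1 / 2 < β) {g : ℝ → ENNReal} (hg : Measurable g)
    {x : ℝ} (hx : 0 < x) (hx1 : x < 1) :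
    (∫⁻ t in Ioo x 1, ENNReal.ofReal (t ^ (-β)) * g t) ^ 2
      ≤ ENNReal.ofReal (x ^ (1 / 2 - β) / (β - 1 / 2)) *
        ∫⁻ t in Ioo x 1, ENNReal.ofReal (t ^ (1 / 2 - β)) * g t ^ 2 := by
  have h := ENNReal.lintegral_mul_le_Lp_mul_Lq (volume.restrict (Ioo x 1))
    (Real.HolderConjugate.two_two)
    (f := fun t => ENNReal.ofReal (t ^ (-(β / 2 + 1 / 4))))
    (g := fun t => ENNReal.ofReal (t ^ (-(β / 2 - 1 / 4))) * g t) (by fun_prop) (by fun_prop)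
  have e0 : ∫⁻ t in Ioo x 1, ((fun t => ENNReal.ofReal (t ^ (-(β / 2 + 1 / 4)))) *
      fun t => ENNReal.ofReal (t ^ (-(β / 2 - 1 / 4))) * g t) t
      = ∫⁻ t in Ioo x 1, ENNReal.ofReal (t ^ (-β)) * g t := by
    refine setLIntegral_congr_fun measurableSet_Ioo fun t ht => ?_
    have ht0 := hx.trans ht.1
    simp only [Pi.mul_apply]
    rw [← mul_assoc, ← ENNReal.ofReal_mul (Real.rpow_nonneg ht0.le _), ← Real.rpow_add ht0]
    ring_nf
  have e1 : ∫⁻ t in Ioo x 1, ENNReal.ofReal (t ^ (-(β / 2 + 1 / 4))) ^ (2 : ℝ)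
      ≤ ENNReal.ofReal (x ^ (1 / 2 - β) / (β - 1 / 2)) := by
    refine le_trans (le_of_eq ?_) ((lintegral_ofReal_rpow_Ioo_le (r := -β - 1 / 2) (by linarith)
      hx hx1).trans_eq ?_)
    · refine setLIntegral_congr_fun measurableSet_Ioo fun t ht => ?_
      have ht0 := hx.trans ht.1
      rw [ENNReal.ofReal_rpow_of_nonneg (Real.rpow_nonneg ht0.le _) zero_le_two,
        ← Real.rpow_mul ht0.le]
      ring_nf
    · ring_nf
  have e2 : ∫⁻ t in Ioo x 1, (ENNReal.ofReal (t ^ (-(β / 2 - 1 / 4))) * g t) ^ (2 : ℝ)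
      = ∫⁻ t in Ioo x 1, ENNReal.ofReal (t ^ (1 / 2 - β)) * g t ^ 2 := by
    refine setLIntegral_congr_fun measurableSet_Ioo fun t ht => ?_
    have ht0 := hx.trans ht.1
    rw [ENNReal.mul_rpow_of_nonneg _ _ zero_le_two,
      ENNReal.ofReal_rpow_of_nonneg (Real.rpow_nonneg ht0.le _) zero_le_two,
      ← Real.rpow_mul ht0.le, ENNReal.rpow_two]
    ring_nf
  rw [e0, e2] at h
  calc _ ≤ _ := pow_le_pow_left' h 2
    _ = (∫⁻ t in Ioo x 1, ENNReal.ofReal (t ^ (-(β / 2 + 1 / 4))) ^ (2 : ℝ)) *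
        ∫⁻ t in Ioo x 1, ENNReal.ofReal (t ^ (1 / 2 - β)) * g t ^ 2 := by
      rw [mul_pow, ← ENNReal.rpow_two, ← ENNReal.rpow_two, ← ENNReal.rpow_mul, ← ENNReal.rpow_mul]
      norm_num
    _ ≤ _ := mul_le_mul_left e1 _

/-- The weighted Hardy inequality for the dual Hardy operator. -/
theorem dual_hardy {β : ℝ} (hβ : 1 / 2 < β) {g : ℝ → ENNReal} (hg : Measurable g) :
    ∫⁻ x in Ioo (0 : ℝ) 1, (ENNReal.ofReal (x ^ (β - 1)) *
        ∫⁻ t in Ioo x 1, ENNReal.ofReal (t ^ (-β)) * g t) ^ 2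
      ≤ ENNReal.ofReal ((β - 1 / 2)⁻¹ ^ 2) * ∫⁻ t in Ioo (0 : ℝ) 1, g t ^ 2 := by
  have hβ' : 0 < β - 1 / 2 := by linarith
  -- Kernel for Tonelli on x < t. The x-weights combine to x^{2(β-1)} x^{1/2-β} = x^{β-3/2}, whose
  -- integral over (0, t) is t^{β-1/2}/(β − 1/2) and cancels the weight t^{1/2-β}.
  set k : ℝ → ℝ → ENNReal := fun x t => (Ioi x).indicator
    (fun t => ENNReal.ofReal (t ^ (1 / 2 - β)) * g t ^ 2) t with hk
  have hkm : Measurable (fun p : ℝ × ℝ => k p.1 p.2) := by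
    have : (fun p : ℝ × ℝ => k p.1 p.2) = {p : ℝ × ℝ | p.1 < p.2}.indicator
        (fun p => ENNReal.ofReal (p.2 ^ (1 / 2 - β)) * g p.2 ^ 2) := by
      ext p; simp [hk, indicator]
    rw [this]
    exact Measurable.indicator (by fun_prop) (measurableSet_lt measurable_fst measurable_snd)
  calc ∫⁻ x in Ioo (0 : ℝ) 1, (ENNReal.ofReal (x ^ (β - 1)) *
        ∫⁻ t in Ioo x 1, ENNReal.ofReal (t ^ (-β)) * g t) ^ 2
      ≤ ∫⁻ x in Ioo (0 : ℝ) 1, ∫⁻ t in Ioo (0 : ℝ) 1,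
          ENNReal.ofReal ((β - 1 / 2)⁻¹ * x ^ (β - 3 / 2)) * k x t := by
        refine setLIntegral_mono' measurableSet_Ioo fun x hx => ?_
        have hsub : Ioi x ∩ Ioo 0 1 = Ioo x 1 := by
          rw [inter_comm, Ioo_inter_Ioi, sup_eq_right.2 hx.1.le]
        rw [lintegral_const_mul' _ _ ENNReal.ofReal_ne_top, lintegral_indicator measurableSet_Ioi,
          Measure.restrict_restrict measurableSet_Ioi, hsub, mul_pow]
        refine (mul_le_mul_right (sq_lintegral_rpow_mul_le hβ hg hx.1 hx.2) _).trans_eq ?_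
        rw [← mul_assoc, ← ENNReal.ofReal_pow (Real.rpow_nonneg hx.1.le _),
          ← ENNReal.ofReal_mul (pow_nonneg (Real.rpow_nonneg hx.1.le _) _)]
        congr 2
        rw [← Real.rpow_mul_natCast hx.1.le, mul_div_assoc', ← Real.rpow_add hx.1, div_eq_inv_mul]
        push_cast
        ring_nf
    _ = ∫⁻ t in Ioo (0 : ℝ) 1, ∫⁻ x in Ioo (0 : ℝ) 1,
          ENNReal.ofReal ((β - 1 / 2)⁻¹ * x ^ (β - 3 / 2)) * k x t :=
        lintegral_lintegral_swap (Measurable.aemeasurable (Measurable.mul (by fun_prop) hkm))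
    _ = ∫⁻ t in Ioo (0 : ℝ) 1, ENNReal.ofReal ((β - 1 / 2)⁻¹ ^ 2) * g t ^ 2 := by
        refine setLIntegral_congr_fun measurableSet_Ioo fun t ht => ?_
        have e : ∀ x, ENNReal.ofReal ((β - 1 / 2)⁻¹ * x ^ (β - 3 / 2)) * k x t =
            ENNReal.ofReal (β - 1 / 2)⁻¹ * (ENNReal.ofReal (t ^ (1 / 2 - β)) * g t ^ 2)
              * (Iio t).indicator (fun x => ENNReal.ofReal (x ^ (β - 3 / 2))) x := by
          intro x
          by_cases hx : x < t
          · simp only [hk, indicator, mem_Ioi, hx, if_true, mem_Iio]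
            rw [ENNReal.ofReal_mul (inv_nonneg.2 hβ'.le)]
            ring
          · simp [hk, hx]
        simp only [e]
        rw [lintegral_const_mul _ (Measurable.indicator (by fun_prop) measurableSet_Iio),
          lintegral_indicator measurableSet_Iio, Measure.restrict_restrict measurableSet_Iio,
          inter_comm, Ioo_inter_Iio, min_eq_right ht.2.le,
          lintegral_ofReal_rpow_Ioo_zero (by linarith) ht.1]
        have e3 : ENNReal.ofReal ((β - 1 / 2)⁻¹ ^ 2) = ENNReal.ofReal (β - 1 / 2)⁻¹ *
            (ENNReal.ofReal (t ^ (1 / 2 - β)) *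
              ENNReal.ofReal (t ^ (β - 3 / 2 + 1) / (β - 3 / 2 + 1))) := by
          rw [← ENNReal.ofReal_mul (Real.rpow_nonneg ht.1.le _),
            ← ENNReal.ofReal_mul (inv_nonneg.2 hβ'.le), mul_div_assoc', ← Real.rpow_add ht.1]
          ring_nf
          rw [Real.rpow_zero]
          ring_nf
        rw [e3]
        ring
    _ = _ := lintegral_const_mul' _ _ ENNReal.ofReal_ne_top

/-- The equation `w' - (β / x) w = h` is solvable in `H¹₀(0,1)` for every `h` when `β > 1/2`. -/
theorem exists_weakDeriv_eq_smul_divX_add {β : ℝ} (hβ : 1 / 2 < β) (h : L2) :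
    ∃ w : H10, weakDeriv (Submodule.inclusion H10_le_H1 w) = (β : ℂ) • divX w + h := by
  have hβ0 : 0 < β := by linarith
  have hβ' : 0 < β - 1 / 2 := by linarith
  obtain ⟨G, hG, hhG⟩ := (Lp.aestronglyMeasurable h).aemeasurable.enorm
  have hK : ∫⁻ t in Ioo (0 : ℝ) 1, G t ^ 2 < ⊤ := by
    have := (eLpNorm_lt_top_iff_lintegral_rpow_enorm_lt_top two_ne_zero ENNReal.ofNat_ne_top).1
      (Lp.memLp h).2
    refine lt_of_eq_of_lt (lintegral_congr_ae ?_) this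
    filter_upwards [hhG] with x hx
    rw [← hx]; simp
  set K := ∫⁻ t in Ioo (0 : ℝ) 1, G t ^ 2 with hKdef
  -- Variation of constants based at 1: w = −x^β ∫ₓ¹ t^{-β}h. The integral may diverge at 0, so p is
  -- only locally integrable; the zero at 1 is automatic.
  set p : ℝ → ℂ := fun t => ((t ^ (-β) : ℝ) : ℂ) * h t with hp
  have hpl : LocallyIntegrableOn p (Ioo (0 : ℝ) 1) :=
    HasLocalWeakDeriv.mul_locallyIntegrableOn (contDiffOn_ofReal_rpow _).continuousOn
      h.locallyIntegrableOn
  have hpI : ∀ x ∈ Ioc (0 : ℝ) 1, ∀ y ∈ Ioc (0 : ℝ) 1, IntervalIntegrable p volume x y := by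
    have key : ∀ x ∈ Ioc (0 : ℝ) 1, IntervalIntegrable p volume x 1 := by
      intro x hx
      rw [intervalIntegrable_iff_integrableOn_Icc_of_le hx.2]
      refine IntegrableOn.continuousOn_mul ?_ ?_ isCompact_Icc
      · exact Complex.continuous_ofReal.comp_continuousOn fun y hy =>
          (Real.continuousAt_rpow_const _ _ (Or.inl (hx.1.trans_le hy.1).ne')).continuousWithinAt
      · rw [integrableOn_Icc_iff_integrableOn_Ioo]
        exact IntegrableOn.mono_set h.integrable (Ioo_subset_Ioo_left hx.1.le)
    exact fun x hx y hy => (key x hx).trans (key y hy).symm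
  set P : ℝ → ℂ := fun x => -∫ t in x..(1 : ℝ), p t with hP
  have hPc : ContinuousOn P (Ioc 0 1) := by
    intro x hx
    have hx2 : x / 2 ∈ Ioc (0 : ℝ) 1 := ⟨half_pos hx.1, by linarith [hx.1, hx.2]⟩
    have := intervalIntegral.continuousOn_primitive_interval_left (f := p) (μ := volume)
      (a := x / 2) (b := 1) (by
        rw [uIcc_of_le hx2.2]
        exact (intervalIntegrable_iff_integrableOn_Icc_of_le hx2.2).1 (hpI _ hx2 1 (by simp)))
    rw [uIcc_of_le hx2.2] at this
    refine ((this.neg x ⟨by linarith [hx.1], hx.2⟩).mono_of_mem_nhdsWithin ?_)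
    filter_upwards [self_mem_nhdsWithin, mem_nhdsWithin_of_mem_nhds
      (Ioi_mem_nhds (show x / 2 < x by linarith [hx.1]))] with y hy hy'
    exact ⟨le_of_lt hy', hy.2⟩
  set F : ℝ → ℂ := fun x => ((x ^ β : ℝ) : ℂ) * P x with hF
  have hPb : ∀ x ∈ Ioo (0 : ℝ) 1, ‖P x‖ₑ ≤ ∫⁻ t in Ioo x 1, ENNReal.ofReal (t ^ (-β)) * G t := by
    intro x hx
    rw [hP, enorm_neg, intervalIntegral.integral_of_le hx.2.le, integral_Ioc_eq_integral_Ioo]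
    refine (enorm_integral_le_lintegral_enorm _).trans_eq (lintegral_congr_ae ?_)
    filter_upwards [ae_restrict_of_ae_restrict_of_subset (Ioo_subset_Ioo_left hx.1.le) hhG,
      ae_restrict_mem measurableSet_Ioo] with t ht ht'
    rw [hp, enorm_mul, ← ht, ← ofReal_norm, Complex.norm_real,
      Real.norm_of_nonneg (Real.rpow_nonneg (hx.1.trans ht'.1).le _)]
  -- The same Cauchy–Schwarz estimate, with t^{1/2-β} ≤ x^{1/2-β} on (x, 1), gives |F(x)|² ≤ Kx/(β −
  -- 1/2) and hence the boundary value 0 at the origin.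
  have hFb : ∀ x ∈ Icc (0 : ℝ) 1, ‖F x‖ ≤ √((β - 1 / 2)⁻¹ * K.toReal * x) := by
    intro x hx
    rcases hx.1.eq_or_lt with rfl | hx0
    · simp [hF, Real.zero_rpow hβ0.ne']
    rcases hx.2.eq_or_lt with rfl | hx1
    · have : F 1 = 0 := by simp [hF, hP]
      rw [this, norm_zero]
      exact Real.sqrt_nonneg _
    have h1 : ‖F x‖ₑ ^ 2 ≤ ENNReal.ofReal ((β - 1 / 2)⁻¹ * x) * K := by
      calc ‖F x‖ₑ ^ 2 ≤ (ENNReal.ofReal (x ^ β) *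
            ∫⁻ t in Ioo x 1, ENNReal.ofReal (t ^ (-β)) * G t) ^ 2 := by
            refine pow_le_pow_left' ?_ 2
            rw [hF, enorm_mul, ← ofReal_norm (((x ^ β : ℝ) : ℂ)), Complex.norm_real,
              Real.norm_of_nonneg (Real.rpow_nonneg hx0.le _)]
            exact mul_le_mul_right (hPb x ⟨hx0, hx1⟩) _
        _ ≤ ENNReal.ofReal (x ^ β) ^ 2 * (ENNReal.ofReal (x ^ (1 / 2 - β) / (β - 1 / 2)) *
            (ENNReal.ofReal (x ^ (1 / 2 - β)) * K)) := by
            rw [mul_pow]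
            refine mul_le_mul_right ((sq_lintegral_rpow_mul_le hβ hG hx0 hx1).trans
              (mul_le_mul_right ?_ _)) _
            rw [hKdef, ← lintegral_const_mul' _ _ ENNReal.ofReal_ne_top]
            refine (setLIntegral_mono' measurableSet_Ioo fun t ht => mul_le_mul_left
              (ENNReal.ofReal_le_ofReal (Real.rpow_le_rpow_of_nonpos hx0 ht.1.le
                (by linarith))) _).trans ?_
            exact lintegral_mono_set (Ioo_subset_Ioo_left hx0.le)
        _ = _ := by
            rw [← mul_assoc, ← mul_assoc, ← ENNReal.ofReal_pow (Real.rpow_nonneg hx0.le _),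
              ← ENNReal.ofReal_mul (by positivity), ← ENNReal.ofReal_mul (by positivity)]
            congr 2
            have : (x ^ β) ^ 2 * x ^ (1 / 2 - β) * x ^ (1 / 2 - β) = x := by
              rw [← Real.rpow_mul_natCast hx0.le, ← Real.rpow_add hx0, ← Real.rpow_add hx0]
              push_cast
              ring_nf
              exact Real.rpow_one x
            rw [mul_div_assoc', div_mul_eq_mul_div, this, div_eq_inv_mul]
    have h2 := ENNReal.toReal_mono (ENNReal.mul_lt_top ENNReal.ofReal_lt_top hK).ne h1
    rw [ENNReal.toReal_pow, toReal_enorm, ENNReal.toReal_mul,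
      ENNReal.toReal_ofReal (by positivity)] at h2
    refine Real.le_sqrt_of_sq_le (h2.trans_eq (by ring))
  have hF0 : F 0 = 0 := by simp [hF, Real.zero_rpow hβ0.ne']
  have hF1 : F 1 = 0 := by simp [hF, hP]
  have hFc : ContinuousOn F (Icc 0 1) := by
    intro x hx
    rcases hx.1.eq_or_lt with rfl | hx0
    · rw [ContinuousWithinAt, hF0]
      refine squeeze_zero_norm' (a := fun x => √((β - 1 / 2)⁻¹ * K.toReal * x)) ?_ ?_
      · filter_upwards [self_mem_nhdsWithin] with y hy using hFb y hy
      · have : Continuous fun x => √((β - 1 / 2)⁻¹ * K.toReal * x) := by fun_prop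
        simpa using (this.tendsto 0).mono_left nhdsWithin_le_nhds
    · have h1 : ContinuousWithinAt F (Ioc 0 1) x :=
        ((Complex.continuous_ofReal.comp
          (Real.continuous_rpow_const hβ0.le)).continuousWithinAt).mul (hPc x ⟨hx0, hx.2⟩)
      refine h1.mono_of_mem_nhdsWithin ?_
      filter_upwards [self_mem_nhdsWithin, mem_nhdsWithin_of_mem_nhds (Ioi_mem_nhds hx0)]
        with y hy hy'
      exact ⟨hy', hy.2⟩
  have hd : MemLp (fun x : ℝ => F x / (x : ℂ)) 2 (volume.restrict (Ioo (0 : ℝ) 1)) := by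
    refine ⟨(((hFc.mono Ioo_subset_Icc_self).aestronglyMeasurable
        measurableSet_Ioo).aemeasurable.div (by fun_prop)).aestronglyMeasurable,
      (eLpNorm_lt_top_iff_lintegral_rpow_enorm_lt_top two_ne_zero ENNReal.ofNat_ne_top).2
        (lt_of_le_of_lt ?_ ((dual_hardy hβ hG).trans_lt
          (ENNReal.mul_lt_top ENNReal.ofReal_lt_top hK)))⟩
    refine setLIntegral_mono' measurableSet_Ioo fun x hx => ?_
    simp only [ENNReal.toReal_ofNat, ENNReal.rpow_two]
    refine pow_le_pow_left' ?_ 2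
    have e : F x / (x : ℂ) = ((x ^ (β - 1) : ℝ) : ℂ) * P x := by
      rw [Real.rpow_sub_one hx.1.ne', hF]
      push_cast
      ring
    rw [e, enorm_mul, ← ofReal_norm (((x ^ (β - 1) : ℝ) : ℂ)), Complex.norm_real,
      Real.norm_of_nonneg (Real.rpow_nonneg hx.1.le _)]
    exact mul_le_mul_right (hPb x hx) _
  have hPw : HasLocalWeakDeriv P p := by
    refine .of_primitive hpl (hPc.mono fun x hx => ⟨hx.1, hx.2.le⟩) fun x hx y hy _ => ?_
    have := intervalIntegral.integral_add_adjacent_intervals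
      (hpI x ⟨hx.1, hx.2.le⟩ y ⟨hy.1, hy.2.le⟩) (hpI y ⟨hy.1, hy.2.le⟩ 1 (by simp))
    simp only [hP]
    rw [← this]; ring
  have hFw := hPw.mul (contDiffOn_ofReal_rpow β) fun x hx => hasDerivAt_ofReal_rpow β hx.1
  obtain ⟨f, hf, hfd⟩ := exists_H10_of_hasLocalWeakDeriv (h := h) (q := fun _ => β) (C := β)
    hFc hF0 hF1 hd continuousOn_const (fun _ _ => (abs_of_pos hβ0).le) (by
      refine hFw.congr (Filter.EventuallyEq.refl _ _) ?_
      filter_upwards [ae_restrict_mem measurableSet_Ioo] with x hx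
      have h1 : ((x ^ β : ℝ) : ℂ) * ((x ^ (-β) : ℝ) : ℂ) = 1 := by
        rw [← Complex.ofReal_mul, ← Real.rpow_add hx.1, add_neg_cancel, Real.rpow_zero,
          Complex.ofReal_one]
      rw [hp, ← mul_assoc (((x ^ β : ℝ) : ℂ)), h1, one_mul, hF, Real.rpow_sub_one hx.1.ne']
      push_cast
      ring)
  refine ⟨f, Lp.ext ?_⟩
  filter_upwards [hfd, Lp.coeFn_add ((β : ℂ) • divX f) h, Lp.coeFn_smul (β : ℂ) (divX f)]
    with x h1 h2 h3
  rw [h1, h2, Pi.add_apply, h3, Pi.smul_apply, smul_eq_mul]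

/-! ### Inner products, density of test functions and Hardy's inequality in norm -/

theorem IsTest.star {φ : ℝ → ℂ} (h : IsTest φ) :
    IsTest (fun x => (starRingEnd ℂ) (φ x)) := by
  obtain ⟨a, b, ha, hb, -, hz⟩ := h.exists_Icc
  exact IsTest.of_Icc (Complex.conjCLE.contDiff.comp h.smooth) ha hb
    fun x hx => by rw [hz x hx, map_zero]

theorem IsTest.hasDerivAt {φ : ℝ → ℂ} (h : IsTest φ) (x : ℝ) : HasDerivAt φ (deriv φ x) x :=
  ((contDiff_infty_iff_deriv.1 h.smooth).1 x).hasDerivAt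

theorem IsTest.deriv_star {φ : ℝ → ℂ} (h : IsTest φ) (x : ℝ) :
    deriv (fun x => (starRingEnd ℂ) (φ x)) x = (starRingEnd ℂ) (deriv φ x) :=
  (h.hasDerivAt x).star.deriv

theorem L2.inner_eq (f g : L2) :
    inner ℂ f g = ∫ x in Ioo (0 : ℝ) 1, (starRingEnd ℂ) (f x) * g x := by
  rw [MeasureTheory.L2.inner_def]
  exact integral_congr_ae (Filter.Eventually.of_forall fun x => RCLike.inner_apply' _ _)

/-- The weak derivative on `H¹₀(0,1)`. -/
noncomputable def derivH10 : H10 →ₗ[ℂ] L2 := weakDeriv ∘ₗ Submodule.inclusion H10_le_H1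

theorem hasWeakDeriv_derivH10 (f : H10) : HasWeakDeriv f (derivH10 f) :=
  hasWeakDeriv_weakDeriv (Submodule.inclusion H10_le_H1 f)

theorem A_apply (γ : ℝ) (f : H10) :
    A γ f = Complex.I • derivH10 f + (Complex.I * (γ : ℂ)) • divX f := rfl

theorem IsTest.memLp {φ : ℝ → ℂ} (h : IsTest φ) :
    MemLp φ 2 (volume.restrict (Ioo (0 : ℝ) 1)) :=
  (h.smooth.continuous.memLp_of_hasCompactSupport h.compact).restrict _

theorem derivH10_ae_of_test {t : H10} {φ : ℝ → ℂ} (hφ : IsTest φ)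
    (h : (t : L2) =ᵐ[volume.restrict (Ioo (0 : ℝ) 1)] φ) :
    derivH10 t =ᵐ[volume.restrict (Ioo (0 : ℝ) 1)] deriv φ := by
  have hw : HasLocalWeakDeriv φ (deriv φ) :=
    .of_hasDerivAt hφ.smooth.contDiffOn fun x _ => hφ.hasDerivAt x
  have := hasLocalWeakDeriv_iff.1 (hw.congr h.symm hφ.deriv_test.memLp.coeFn_toLp.symm)
  rw [(hasWeakDeriv_derivH10 t).unique this]
  exact hφ.deriv_test.memLp.coeFn_toLp

theorem IsTest.exists_H10 {φ : ℝ → ℂ} (hφ : IsTest φ) :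
    ∃ t : H10, (t : L2) ∈ testSpace ∧ (t : L2) =ᵐ[volume.restrict (Ioo (0 : ℝ) 1)] φ :=
  have ht : hφ.memLp.toLp φ ∈ testSpace := ⟨φ, hφ, hφ.memLp.coeFn_toLp⟩
  ⟨⟨_, testSpace_le_H10 ht⟩, ht, hφ.memLp.coeFn_toLp⟩

/-- A vector h orthogonal to all test functions is a weak derivative of 0, so uniqueness of weak
derivatives gives h = 0. -/
theorem dense_testSpace : Dense (testSpace : Set L2) := by
  rw [Submodule.dense_iff_topologicalClosure_eq_top, Submodule.topologicalClosure_eq_top_iff,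
    Submodule.eq_bot_iff]
  intro h hh
  refine HasWeakDeriv.unique (f := 0) (fun φ hφ => ?_) hasWeakDeriv_zero
  obtain ⟨t, ht, hte⟩ := hφ.star.exists_H10
  have e : ∫ x in Ioo (0 : ℝ) 1, h x * φ x = inner ℂ (t : L2) h := by
    rw [L2.inner_eq]
    refine integral_congr_ae (hte.mono fun x hx => ?_)
    simp only [hx, Complex.conj_conj, mul_comm]
  rw [e, hh _ ht, neg_zero]
  refine integral_eq_zero_of_ae ?_
  filter_upwards [Lp.coeFn_zero ℂ 2 (volume.restrict (Ioo (0 : ℝ) 1))] with x hx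
  rw [hx]; simp

theorem continuousOn_primitive (g : L2) :
    ContinuousOn (fun x => ∫ t in (0 : ℝ)..x, g t) (Icc 0 1) := by
  have := intervalIntegral.continuousOn_primitive_interval (f := g) (μ := volume) (a := 0) (b := 1)
    (by rw [uIcc_of_le zero_le_one, integrableOn_Icc_iff_integrableOn_Ioo]; exact g.integrable)
  rwa [uIcc_of_le zero_le_one] at this

theorem HasWeakDeriv.exists_const {f g : L2} (h : HasWeakDeriv f g) :
    ∃ c : ℂ, f =ᵐ[volume.restrict (Ioo (0 : ℝ) 1)] fun x => c + ∫ t in (0 : ℝ)..x, g t := by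
  obtain ⟨⟨c, hc⟩, ⟨d, hd⟩⟩ := h.exists_re_im
  refine ⟨c + d * Complex.I, ?_⟩
  filter_upwards [hc, hd, ae_restrict_mem measurableSet_Ioo] with x h1 h2 hx
  have hi : IntegrableOn g (Ioc 0 x) := IntegrableOn.mono_set
    ((integrableOn_Ioc_iff_integrableOn_Ioo (μ := volume)).2 g.integrable)
    (Ioc_subset_Ioc_right hx.2.le)
  have e := integral_re_add_im (𝕜 := ℂ) hi
  rw [intervalIntegral.integral_of_le hx.1.le] at h1 h2 ⊢
  simp only [RCLike.re_to_complex, RCLike.im_to_complex, RCLike.I_to_complex,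
    RCLike.ofReal_eq_complex_ofReal] at e
  rw [← e, ← Complex.re_add_im (f x), h1, h2]
  push_cast
  ring

/-- The integration constant is the boundary value at 0, and the total integral is then the boundary
value at 1. -/
theorem eq_primitive_of_mem_H10 (f : H10) :
    ((f : L2) =ᵐ[volume.restrict (Ioo (0 : ℝ) 1)] fun x => ∫ t in (0 : ℝ)..x, derivH10 f t) ∧
      ∫ t in (0 : ℝ)..1, derivH10 f t = 0 := by
  obtain ⟨c, hc⟩ := (hasWeakDeriv_derivH10 f).exists_const
  obtain ⟨F, hF, hfF, h0, h1⟩ := f.2.2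
  have := Measure.eqOn_Icc_of_ae_eq volume (zero_ne_one' ℝ) (f := F)
    (g := fun x => c + ∫ t in (0 : ℝ)..x, derivH10 f t) (by
      rw [← restrict_Ioo_eq_restrict_Icc]
      filter_upwards [hc, hfF] with x hx hx'
      rw [← hx', hx]) hF (continuousOn_const.add (continuousOn_primitive _))
  have e0 := this (left_mem_Icc.2 zero_le_one)
  have e1 := this (right_mem_Icc.2 zero_le_one)
  simp only [h0, h1, intervalIntegral.integral_same, add_zero] at e0 e1
  subst e0
  simp only [zero_add] at hc e1
  exact ⟨hc, e1.symm⟩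

theorem L2.enorm_sq (f : L2) : ‖f‖ₑ ^ 2 = ∫⁻ x in Ioo (0 : ℝ) 1, ‖f x‖ₑ ^ 2 := by
  rw [Lp.enorm_def, eLpNorm_eq_lintegral_rpow_enorm_toReal two_ne_zero ENNReal.ofNat_ne_top]
  simp only [ENNReal.toReal_ofNat, ENNReal.rpow_two]
  rw [← ENNReal.rpow_two, ← ENNReal.rpow_mul]
  norm_num

/-- Hardy's inequality on `H¹₀(0,1)`. -/
theorem norm_divX_le (f : H10) : ‖divX f‖ ≤ 2 * ‖derivH10 f‖ := by
  obtain ⟨G, hG, hgG⟩ := (Lp.aestronglyMeasurable (derivH10 f)).aemeasurable.enorm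
  have h : ‖divX f‖ₑ ^ 2 ≤ 4 * ‖derivH10 f‖ₑ ^ 2 := by
    rw [L2.enorm_sq, L2.enorm_sq]
    calc _ ≤ _ := ?_
      _ ≤ _ := hardy hG
      _ = _ := by
        congr 1
        exact lintegral_congr_ae (hgG.mono fun x hx => by simp only [← hx])
    refine lintegral_mono_ae ?_
    filter_upwards [(eq_primitive_of_mem_H10 f).1, ae_restrict_mem measurableSet_Ioo, coeFn_divX f]
      with x hx hx' hd
    refine pow_le_pow_left' ?_ 2
    rw [hd, div_eq_inv_mul, enorm_mul]
    refine mul_le_mul' (le_of_eq ?_) ?_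
    · rw [← Complex.ofReal_inv, ← ofReal_norm, Complex.norm_real,
        Real.norm_of_nonneg (inv_nonneg.2 hx'.1.le)]
    · rw [hx, intervalIntegral.integral_of_le hx'.1.le, integral_Ioc_eq_integral_Ioo]
      exact (enorm_integral_le_lintegral_enorm _).trans_eq (lintegral_congr_ae
        (ae_restrict_of_ae_restrict_of_subset (Ioo_subset_Ioo_right hx'.2.le) hgG))
  have h' := ENNReal.toReal_mono (ENNReal.mul_ne_top (by norm_num)
    (ENNReal.pow_ne_top enorm_ne_top)) h
  simp only [ENNReal.toReal_pow, ENNReal.toReal_mul, toReal_enorm, ENNReal.toReal_ofNat] at h'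
  refine abs_le_of_sq_le_sq' (h'.trans_eq (by ring)) (by positivity) |>.2

theorem norm_le_norm_divX (f : H10) : ‖(f : L2)‖ ≤ ‖divX f‖ := by
  refine Lp.norm_le_norm_of_ae_le ?_
  filter_upwards [ae_restrict_mem measurableSet_Ioo, coeFn_divX f] with x hx hd
  rw [hd, norm_div, Complex.norm_real, Real.norm_of_nonneg hx.1.le]
  exact le_div_self (norm_nonneg _) hx.1 hx.2.le

/-- Test functions are dense in `H¹₀(0,1)`. -/
theorem exists_seq_test (f : H10) : ∃ t : ℕ → H10, (∀ n, (t n : L2) ∈ testSpace) ∧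
    Filter.Tendsto (fun n => (t n : L2)) Filter.atTop (nhds f) ∧
    Filter.Tendsto (fun n => derivH10 (t n)) Filter.atTop (nhds (derivH10 f)) ∧
    Filter.Tendsto (fun n => divX (t n)) Filter.atTop (nhds (divX f)) := by
  set K : Submodule ℂ L2 := (testSpace.comap H10.subtype).map derivH10 with hK
  -- A vector orthogonal to the derivatives of all test functions has weak derivative 0, hence is
  -- constant; f' has mean zero and is orthogonal to constants.
  have hmem : derivH10 f ∈ K.topologicalClosure := by
    rw [← Submodule.orthogonal_orthogonal_eq_closure]
    intro h hh
    have hw : HasWeakDeriv h 0 := by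
      intro φ hφ
      obtain ⟨t, ht, hte⟩ := hφ.star.exists_H10
      have e : ∫ x in Ioo (0 : ℝ) 1, h x * deriv φ x = inner ℂ (derivH10 t) h := by
        rw [L2.inner_eq]
        refine integral_congr_ae ((derivH10_ae_of_test hφ.star hte).mono fun x hx => ?_)
        simp only [hx, hφ.deriv_star, Complex.conj_conj, mul_comm]
      rw [e, hh _ ⟨t, ht, rfl⟩, eq_comm, neg_eq_zero]
      refine integral_eq_zero_of_ae ?_
      filter_upwards [Lp.coeFn_zero ℂ 2 (volume.restrict (Ioo (0 : ℝ) 1))] with x hx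
      rw [hx]; simp
    obtain ⟨c, hc⟩ := hw.exists_const
    rw [L2.inner_eq]
    have e : ∫ x in Ioo (0 : ℝ) 1, (starRingEnd ℂ) (h x) * derivH10 f x
        = ∫ x in Ioo (0 : ℝ) 1, (starRingEnd ℂ) c * derivH10 f x := by
      refine integral_congr_ae ?_
      filter_upwards [hc, ae_restrict_mem measurableSet_Ioo] with x hx hx'
      have z : ∫ t in (0 : ℝ)..x, (0 : L2) t = 0 := by
        rw [intervalIntegral.integral_of_le hx'.1.le, integral_Ioc_eq_integral_Ioo]
        exact integral_eq_zero_of_ae (ae_restrict_of_ae_restrict_of_subset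
          (Ioo_subset_Ioo_right hx'.2.le) (Lp.coeFn_zero ℂ 2 _))
      rw [hx, z, add_zero]
    rw [e, integral_const_mul, ← integral_Ioc_eq_integral_Ioo,
      ← intervalIntegral.integral_of_le zero_le_one, (eq_primitive_of_mem_H10 f).2, mul_zero]
  obtain ⟨g, hg, hgt⟩ := mem_closure_iff_seq_limit.1 hmem
  choose t ht htg using hg
  obtain rfl : (fun n => derivH10 (t n)) = g := funext htg
  -- Hardy's inequality converts convergence of the derivatives into convergence of tₙ/x, which in
  -- turn dominates tₙ.
  have h1 : Filter.Tendsto (fun n => divX (t n)) Filter.atTop (nhds (divX f)) := by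
    rw [tendsto_iff_norm_sub_tendsto_zero] at hgt ⊢
    refine squeeze_zero (fun _ => norm_nonneg _) (fun n => ?_)
      (by simpa using hgt.const_mul 2)
    rw [← map_sub, ← map_sub]
    exact norm_divX_le _
  refine ⟨t, ht, ?_, hgt, h1⟩
  rw [tendsto_iff_norm_sub_tendsto_zero] at h1 ⊢
  refine squeeze_zero (fun _ => norm_nonneg _) (fun n => ?_) h1
  rw [← map_sub, ← Submodule.coe_sub]
  exact norm_le_norm_divX _

/-- For test functions integration by parts reads ⟨t', t⟩ = −⟨t, t'⟩; density in H¹₀ does the rest.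
This is why the differential part of A contributes nothing to Im⟨f, Af⟩. -/
theorem re_inner_derivH10 (f : H10) : (inner ℂ (f : L2) (derivH10 f)).re = 0 := by
  have key : ∀ t : H10, (t : L2) ∈ testSpace → (inner ℂ (t : L2) (derivH10 t)).re = 0 := by
    rintro t ⟨φ, hφ, hte⟩
    have hd := derivH10_ae_of_test hφ hte
    have e := hasWeakDeriv_derivH10 t _ hφ.star
    have e1 : ∫ x in Ioo (0 : ℝ) 1, (t : L2) x * deriv (fun x => (starRingEnd ℂ) (φ x)) x
        = inner ℂ (derivH10 t) (t : L2) := by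
      rw [L2.inner_eq]
      refine integral_congr_ae (hd.mono fun x hx => ?_)
      simp only [hx, hφ.deriv_star, mul_comm]
    have e2 : ∫ x in Ioo (0 : ℝ) 1, derivH10 t x * (starRingEnd ℂ) (φ x)
        = inner ℂ (t : L2) (derivH10 t) := by
      rw [L2.inner_eq]
      refine integral_congr_ae (hte.mono fun x hx => ?_)
      simp only [hx, mul_comm]
    rw [e1, e2, ← inner_conj_symm] at e
    have := congrArg Complex.re e
    simp only [Complex.conj_re, Complex.neg_re] at this
    linarith
  obtain ⟨t, ht, h1, h2, -⟩ := exists_seq_test f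
  refine tendsto_nhds_unique
    ((Complex.continuous_re.tendsto _).comp (h1.inner h2)) ?_
  refine tendsto_const_nhds.congr fun n => ?_
  simp only [Function.comp_apply]
  exact (key (t n) (ht n)).symm

/-! ### The factor V^{1/2} on H¹₀ and the imaginary part of A -/

variable {γ : ℝ}

theorem coeFn_invSqrtV (γ : ℝ) (f : L2) :
    invSqrtV γ f =ᵐ[volume.restrict (Ioo (0 : ℝ) 1)] fun x => (√(x / γ) : ℂ) * f x :=
  (memLp_sqrt_mul γ f).coeFn_toLp

theorem inner_invSqrtV (γ : ℝ) (f g : L2) :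
    inner ℂ (invSqrtV γ f) g = inner ℂ f (invSqrtV γ g) := by
  rw [L2.inner_eq, L2.inner_eq]
  refine integral_congr_ae ?_
  filter_upwards [coeFn_invSqrtV γ f, coeFn_invSqrtV γ g] with x h1 h2
  rw [h1, h2, map_mul, Complex.conj_ofReal]
  ring

/-- Multiplication by `√(γ / x)` on `H¹₀(0,1)`. -/
noncomputable def sqrtV (γ : ℝ) : H10 →ₗ[ℂ] L2 := (γ : ℂ) • (invSqrtV γ ∘ₗ divX)

theorem sqrtV_apply (γ : ℝ) (f : H10) : sqrtV γ f = (γ : ℂ) • invSqrtV γ (divX f) := rfl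

theorem coeFn_sqrtV (hγ : 0 < γ) (f : H10) :
    sqrtV γ f =ᵐ[volume.restrict (Ioo (0 : ℝ) 1)]
      fun x => (√γ : ℂ) * (f : L2) x / (√x : ℂ) := by
  rw [sqrtV_apply]
  filter_upwards [Lp.coeFn_smul (γ : ℂ) (invSqrtV γ (divX f)), coeFn_invSqrtV γ (divX f),
    coeFn_divX f, ae_restrict_mem measurableSet_Ioo] with x h1 h2 h3 hx
  have e1 : (√γ : ℂ) ^ 2 = γ := by exact_mod_cast Real.sq_sqrt hγ.le
  have e2 : (√x : ℂ) ^ 2 = x := by exact_mod_cast Real.sq_sqrt hx.1.le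
  have n1 : (√γ : ℂ) ≠ 0 := Complex.ofReal_ne_zero.2 (Real.sqrt_pos.2 hγ).ne'
  have n2 : (√x : ℂ) ≠ 0 := Complex.ofReal_ne_zero.2 (Real.sqrt_pos.2 hx.1).ne'
  rw [h1, Pi.smul_apply, h2, h3, smul_eq_mul, Real.sqrt_div hx.1.le, Complex.ofReal_div,
    ← e1, ← e2]
  field_simp

theorem invSqrtV_sqrtV (hγ : 0 < γ) (f : H10) : invSqrtV γ (sqrtV γ f) = f := by
  refine Lp.ext ?_
  filter_upwards [coeFn_invSqrtV γ (sqrtV γ f), coeFn_sqrtV hγ f,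
    ae_restrict_mem measurableSet_Ioo] with x h1 h2 hx
  have n1 : (√γ : ℂ) ≠ 0 := Complex.ofReal_ne_zero.2 (Real.sqrt_pos.2 hγ).ne'
  have n2 : (√x : ℂ) ≠ 0 := Complex.ofReal_ne_zero.2 (Real.sqrt_pos.2 hx.1).ne'
  rw [h1, h2, Real.sqrt_div hx.1.le, Complex.ofReal_div]
  field_simp

theorem sqrtV_eq_of_invSqrtV_eq (hγ : 0 < γ) {f : H10} {g : L2} (h : invSqrtV γ g = f) :
    sqrtV γ f = g := by
  refine Lp.ext ?_
  have e := coeFn_invSqrtV γ g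
  rw [h] at e
  filter_upwards [e, coeFn_sqrtV hγ f, ae_restrict_mem measurableSet_Ioo] with x h1 h2 hx
  have n1 : (√γ : ℂ) ≠ 0 := Complex.ofReal_ne_zero.2 (Real.sqrt_pos.2 hγ).ne'
  have n2 : (√x : ℂ) ≠ 0 := Complex.ofReal_ne_zero.2 (Real.sqrt_pos.2 hx.1).ne'
  rw [h2, h1, Real.sqrt_div hx.1.le, Complex.ofReal_div]
  field_simp

/-- The term if' contributes Re⟨f, f'⟩ = 0, and γ⟨f, f/x⟩ becomes ‖V^{1/2}f‖² on writing f =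
V^{-1/2}V^{1/2}f. -/
theorem im_inner_A (hγ : 0 < γ) (f : H10) :
    (inner ℂ (f : L2) (A γ f)).im = ‖sqrtV γ f‖ ^ 2 := by
  have e : (γ : ℂ) * inner ℂ (f : L2) (divX f) = inner ℂ (sqrtV γ f) (sqrtV γ f) := by
    nth_rewrite 1 [← invSqrtV_sqrtV hγ f]
    rw [inner_invSqrtV, ← inner_smul_right]
    rfl
  rw [A_apply, inner_add_right, inner_smul_right, inner_smul_right, mul_assoc, e,
    inner_self_eq_norm_sq_to_K]
  have h := re_inner_derivH10 f
  rw [Complex.add_im, Complex.I_mul_im, Complex.I_mul_im, h, zero_add]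
  norm_cast

theorem inner_sqrtV (s : L2) (f : H10) :
    inner ℂ s (sqrtV γ f) = (γ : ℂ) * inner ℂ (invSqrtV γ s) (divX f) := by
  rw [sqrtV_apply, inner_smul_right, inner_invSqrtV]

/-- Duality relations against `A` extend from test functions to `H¹₀(0,1)`. -/
theorem inner_A_eq_of_test {v s : L2}
    (h : ∀ f : H10, (f : L2) ∈ testSpace → inner ℂ v (A γ f) = inner ℂ s (sqrtV γ f)) (f : H10) :
    inner ℂ v (A γ f) = inner ℂ s (sqrtV γ f) := by
  -- Both sides depend on f only through f' and f/x, which is where the approximating sequence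
  -- converges.
  obtain ⟨t, ht, -, h2, h3⟩ := exists_seq_test f
  have l1 : Filter.Tendsto (fun n => inner ℂ v (A γ (t n))) Filter.atTop
      (nhds (inner ℂ v (A γ f))) := by
    simp only [A_apply]
    exact tendsto_const_nhds.inner ((h2.const_smul Complex.I).add (h3.const_smul _))
  have l2 : Filter.Tendsto (fun n => inner ℂ s (sqrtV γ (t n))) Filter.atTop
      (nhds (inner ℂ s (sqrtV γ f))) := by
    simp only [inner_sqrtV]
    exact (tendsto_const_nhds.inner h3).const_mul _
  exact tendsto_nhds_unique l1 (l2.congr fun n => (h (t n) (ht n)).symm)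

/-! ### The domain and the action of W* -/

/-- `√x v = w + c x^{γ+1/2}`. -/
def IsDecomp (γ : ℝ) (v : L2) (w : H10) (c : ℂ) : Prop :=
  ∀ᵐ x : ℝ ∂(volume.restrict (Ioo (0 : ℝ) 1)),
    ((√x : ℝ) : ℂ) * v x = (w : L2) x + c * ((x ^ (γ + 1 / 2) : ℝ) : ℂ)

/-- The value of `W*` at `v` with `√x v = w + c x^{γ+1/2}`. -/
noncomputable def decompAdjoint (γ : ℝ) (w : H10) : L2 :=
  (Complex.I / (√γ : ℂ)) • (derivH10 w - ((γ + 1 / 2 : ℝ) : ℂ) • divX w)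

theorem coeFn_decompAdjoint (γ : ℝ) (w : H10) :
    decompAdjoint γ w =ᵐ[volume.restrict (Ioo (0 : ℝ) 1)] fun x => (Complex.I / (√γ : ℂ)) *
      (derivH10 w x - (γ + 1 / 2) * ((w : L2) x / (x : ℂ))) := by
  filter_upwards [Lp.coeFn_smul (Complex.I / (√γ : ℂ))
      (derivH10 w - ((γ + 1 / 2 : ℝ) : ℂ) • divX w),
    Lp.coeFn_sub (derivH10 w) (((γ + 1 / 2 : ℝ) : ℂ) • divX w),
    Lp.coeFn_smul ((γ + 1 / 2 : ℝ) : ℂ) (divX w), coeFn_divX w] with x h1 h2 h3 h4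
  rw [decompAdjoint, h1, Pi.smul_apply, h2, Pi.sub_apply, h3, Pi.smul_apply, h4, smul_eq_mul,
    smul_eq_mul]
  push_cast
  ring

theorem hasLocalWeakDeriv_decomp (γ : ℝ) (w : H10) (c : ℂ) :
    HasLocalWeakDeriv (fun x => (w : L2) x + c * ((x ^ (γ + 1 / 2) : ℝ) : ℂ))
      (fun x => derivH10 w x + c * (((γ + 1 / 2) * x ^ (γ + 1 / 2 - 1) : ℝ) : ℂ)) :=
  (hasLocalWeakDeriv_iff.2 (hasWeakDeriv_derivH10 w)).add
    (.of_hasDerivAt (contDiffOn_const.mul (contDiffOn_ofReal_rpow _))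
      fun _ hx => (hasDerivAt_ofReal_rpow _ hx.1).const_mul c)

/-- Integration by parts of v = x^{-1/2}w + c x^γ against a test function. The pointwise identity
behind it is √(γ/x) s = iv' − i(γ/x)v with s = W*v, and x^γ is a solution for s = 0, so c drops out.
-/
theorem IsDecomp.inner_A (hγ : 0 < γ) {v : L2} {w : H10} {c : ℂ} (h : IsDecomp γ v w c) (f : H10) :
    inner ℂ v (A γ f) = inner ℂ (decompAdjoint γ w) (sqrtV γ f) := by
  refine inner_A_eq_of_test (fun t ht => ?_) f
  obtain ⟨φ, hφ, hte⟩ := ht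
  have hsm : ContDiffOn ℝ ∞ (fun x : ℝ => (((√x)⁻¹ : ℝ) : ℂ)) (Ioo 0 1) :=
    Complex.ofRealCLM.contDiff.comp_contDiffOn
      (ContDiffOn.inv (fun x hx => (Real.contDiffAt_sqrt hx.1.ne').contDiffWithinAt)
        fun x hx => (Real.sqrt_pos.2 hx.1).ne')
  have hL := (hasLocalWeakDeriv_decomp γ w c).mul hsm fun x hx =>
    ((Real.hasDerivAt_sqrt hx.1.ne').inv (Real.sqrt_pos.2 hx.1).ne').ofReal_comp
  have e1 := hL.integral_mul_deriv _ hφ.star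
  have i1 := integrableOn_mul_test hL.locInt hφ.star.deriv_test
  have i2 := integrableOn_mul_test hL.locInt' hφ.star
  have e2 := integral_add i1 i2
  rw [e1, neg_add_cancel] at e2
  have i3 : Integrable (fun x => (starRingEnd ℂ) (sqrtV γ t x) * decompAdjoint γ w x)
      (volume.restrict (Ioo (0 : ℝ) 1)) :=
    (MeasureTheory.L2.integrable_inner (𝕜 := ℂ) (sqrtV γ t) (decompAdjoint γ w)).congr
      (Filter.Eventually.of_forall fun x => RCLike.inner_apply' _ _)
  rw [← inner_conj_symm, ← inner_conj_symm (decompAdjoint γ w), L2.inner_eq, L2.inner_eq]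
  congr 1
  -- The integrand of (vφ̄)' has integral zero; adding −i times it to one side makes the two
  -- integrands agree almost everywhere.
  have i4 := (i1.add i2).const_mul (-Complex.I)
  have e3 := integral_add i3 i4
  simp only [Pi.add_apply] at e3
  rw [integral_const_mul, e2, mul_zero, add_zero] at e3
  rw [← e3]
  refine integral_congr_ae ?_
  filter_upwards [A_apply_ae γ t (hasWeakDeriv_derivH10 t), coeFn_sqrtV hγ t,
    coeFn_decompAdjoint γ w, derivH10_ae_of_test hφ hte, hte, h, ae_restrict_mem measurableSet_Ioo]
    with x h1 h2 h3 h4 h5 h6 hx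
  have e1 : (√γ : ℂ) ^ 2 = γ := by exact_mod_cast Real.sq_sqrt hγ.le
  have e2 : (√x : ℂ) ^ 2 = x := by exact_mod_cast Real.sq_sqrt hx.1.le
  have n1 : (√γ : ℂ) ≠ 0 := Complex.ofReal_ne_zero.2 (Real.sqrt_pos.2 hγ).ne'
  have n2 : (√x : ℂ) ≠ 0 := Complex.ofReal_ne_zero.2 (Real.sqrt_pos.2 hx.1).ne'
  have hv : v x = ((w : L2) x + c * ((x ^ (γ + 1 / 2) : ℝ) : ℂ)) / (√x : ℂ) := by
    rw [← h6]; field_simp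
  rw [h1, h2, h3, h4, h5, hv, hφ.deriv_star, Real.rpow_sub_one hx.1.ne']
  simp only [map_add, map_mul, map_div₀, Complex.conj_I, Complex.conj_ofReal]
  push_cast
  rw [← e1, ← e2]
  field_simp
  ring

theorem memLp_of_continuous {F : ℝ → ℂ} (hF : Continuous F) :
    MemLp F 2 (volume.restrict (Ioo (0 : ℝ) 1)) := by
  obtain ⟨C, hC⟩ := isCompact_Icc.exists_bound_of_continuousOn (s := Icc (0 : ℝ) 1) hF.continuousOn
  refine MemLp.of_bound hF.aestronglyMeasurable C ?_
  filter_upwards [ae_restrict_mem measurableSet_Ioo] with x hx using hC x (Ioo_subset_Icc_self hx)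

theorem memLp_rpow_mul_exp (hγ : 0 < γ) (κ : ℝ) :
    MemLp (fun t : ℝ => ((t ^ γ * Real.exp (κ * t) : ℝ) : ℂ)) 2
      (volume.restrict (Ioo (0 : ℝ) 1)) :=
  memLp_of_continuous (Complex.continuous_ofReal.comp
    ((Real.continuous_rpow_const hγ.le).mul (by fun_prop)))

/-- The function `x^γ e^{κx}`, spanning the orthogonal complement of the range of `A + iκ`. -/
noncomputable def defectVec (hγ : 0 < γ) (κ : ℝ) : L2 := (memLp_rpow_mul_exp hγ κ).toLp _

theorem coeFn_defectVec (hγ : 0 < γ) (κ : ℝ) :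
    defectVec hγ κ =ᵐ[volume.restrict (Ioo (0 : ℝ) 1)]
      fun t => ((t ^ γ * Real.exp (κ * t) : ℝ) : ℂ) := (memLp_rpow_mul_exp hγ κ).coeFn_toLp

theorem exists_A_add_smul_eq_of_inner (hγ : 0 < γ) {κ : ℝ} (hκ : 0 ≤ κ) {u : L2}
    (hu : inner ℂ (defectVec hγ κ) u = 0) :
    ∃ f : H10, A γ f + (Complex.I * κ) • (f : L2) = u := by
  refine exists_A_add_smul_eq hγ hκ u (Eq.trans (integral_congr_ae ?_) ((L2.inner_eq _ _).symm.trans hu))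
  filter_upwards [coeFn_defectVec hγ κ] with x hx
  rw [hx, Complex.conj_ofReal]

/-- With κ = 0, ran A contains the orthogonal complement of x^γ, so a vector orthogonal to ran A
lies in the double complement of a line. -/
theorem mem_span_defectVec (hγ : 0 < γ) {z : L2} (hz : ∀ f : H10, inner ℂ z (A γ f) = 0) :
    ∃ c : ℂ, z = c • defectVec hγ 0 := by
  have : z ∈ (Submodule.span ℂ {defectVec hγ 0})ᗮᗮ := by
    intro u hu
    obtain ⟨f, rfl⟩ := exists_A_add_smul_eq_of_inner hγ le_rfl
      (Submodule.mem_orthogonal_singleton_iff_inner_right.1 hu)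
    rw [← inner_conj_symm]
    simp [hz f]
  rw [Submodule.orthogonal_orthogonal] at this
  obtain ⟨c, hc⟩ := Submodule.mem_span_singleton.1 this
  exact ⟨c, hc.symm⟩

theorem sqrtV_mem_W_domain (hγ : 0 < γ) {f : H10} (hf : (f : L2) ∈ testSpace) :
    sqrtV γ f ∈ (W γ).domain := by
  change invSqrtV γ (sqrtV γ f) ∈ (A₀ γ).domain
  rw [invSqrtV_sqrtV hγ, A₀_domain]
  exact hf

theorem W_apply (γ : ℝ) (g : (W γ).domain) (f : H10) (h : invSqrtV γ (g : L2) = f) :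
    W γ g = A γ f := by
  have hf : invSqrtV γ (g : L2) ∈ H10 := h ▸ f.2
  have e : (⟨_, hf⟩ : H10) = f := Subtype.ext h
  rw [← e]
  rfl

/-- Multiplication by √(x/γ) preserves test functions, so D(W) contains them. Density is what makes
the adjoint satisfy its defining relation. -/
theorem dense_W_domain (hγ : 0 < γ) : Dense ((W γ).domain : Set L2) := by
  refine dense_testSpace.mono ?_
  rintro g ⟨φ, hφ, hg⟩
  change invSqrtV γ g ∈ (A₀ γ).domain
  rw [A₀_domain]
  refine ⟨fun x => (√(x / γ) : ℂ) * φ x, hφ.contDiffOn_mul ?_, ?_⟩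
  · exact Complex.ofRealCLM.contDiff.comp_contDiffOn fun x hx =>
      ((Real.contDiffAt_sqrt (div_pos hx.1 hγ).ne').comp x
        (contDiffAt_id.div_const γ)).contDiffWithinAt
  · filter_upwards [coeFn_invSqrtV γ g, hg] with x h1 h2
    rw [h1, h2]

/-- D(W) is the image of the test functions under V^{1/2}, where W V^{1/2}f = Af; the resulting
duality relation then extends to all of H¹₀. -/
theorem mem_Wstar_domain_iff (hγ : 0 < γ) {v : L2} : v ∈ (Wstar γ).domain ↔
    ∃ s : L2, ∀ f : H10, inner ℂ v (A γ f) = inner ℂ s (sqrtV γ f) := by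
  constructor
  · intro hv
    refine ⟨Wstar γ ⟨v, hv⟩, inner_A_eq_of_test fun f hf => ?_⟩
    have := LinearPMap.adjoint_isFormalAdjoint (dense_W_domain hγ) ⟨v, hv⟩
      ⟨sqrtV γ f, sqrtV_mem_W_domain hγ hf⟩
    rw [W_apply γ _ f (invSqrtV_sqrtV hγ f)] at this
    exact this.symm
  · rintro ⟨s, hs⟩
    refine LinearPMap.mem_adjoint_domain_of_exists _ ⟨s, fun g => ?_⟩
    have hg : invSqrtV γ (g : L2) ∈ (A₀ γ).domain := g.2
    rw [A₀_domain] at hg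
    set f : H10 := ⟨_, testSpace_le_H10 hg⟩ with hf
    rw [W_apply γ g f rfl, hs, sqrtV_eq_of_invSqrtV_eq hγ (f := f) (g := (g : L2)) rfl]

theorem exists_isDecomp (hγ : 0 < γ) {v : L2} (hv : v ∈ (Wstar γ).domain) :
    ∃ w c, IsDecomp γ v w c := by
  obtain ⟨s, hs⟩ := (mem_Wstar_domain_iff hγ).1 hv
  have n1 : (√γ : ℂ) ≠ 0 := Complex.ofReal_ne_zero.2 (Real.sqrt_pos.2 hγ).ne'
  obtain ⟨w, hw⟩ := exists_weakDeriv_eq_smul_divX_add (β := γ + 1 / 2) (by linarith)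
    ((-Complex.I * (√γ : ℂ)) • s)
  have hw' : decompAdjoint γ w = s := by
    change derivH10 w = _ at hw
    rw [decompAdjoint, hw, add_sub_cancel_left, smul_smul]
    have : Complex.I / (√γ : ℂ) * (-Complex.I * (√γ : ℂ)) = 1 := by
      field_simp
      simp
    rw [this, one_smul]
  -- This is w/√x: the decomposable function with c = 0 having the same adjoint value s as v.
  set v₁ : L2 := ((√γ : ℂ)⁻¹) • sqrtV γ w with hv₁
  have e₁ : v₁ =ᵐ[volume.restrict (Ioo (0 : ℝ) 1)] fun x => (w : L2) x / (√x : ℂ) := by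
    filter_upwards [Lp.coeFn_smul ((√γ : ℂ)⁻¹) (sqrtV γ w), coeFn_sqrtV hγ w] with x h1 h2
    rw [h1, Pi.smul_apply, h2, smul_eq_mul]
    field_simp
  have d₁ : IsDecomp γ v₁ w 0 := by
    filter_upwards [e₁, ae_restrict_mem measurableSet_Ioo] with x h1 hx
    have n2 : (√x : ℂ) ≠ 0 := Complex.ofReal_ne_zero.2 (Real.sqrt_pos.2 hx.1).ne'
    rw [h1]
    field_simp
    ring
  obtain ⟨c, hc⟩ := mem_span_defectVec hγ (z := v - v₁) fun f => by
    rw [inner_sub_left, hs, d₁.inner_A hγ, hw', sub_self]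
  refine ⟨w, c, ?_⟩
  have hv' : v = v₁ + c • defectVec hγ 0 := by rw [← hc]; abel
  filter_upwards [d₁, Lp.coeFn_add v₁ (c • defectVec hγ 0), Lp.coeFn_smul c (defectVec hγ 0),
    coeFn_defectVec hγ 0, ae_restrict_mem measurableSet_Ioo] with x h1 h2 h3 h4 hx
  have e : x ^ (γ + 1 / 2) = √x * x ^ γ := by
    rw [Real.rpow_add hx.1, ← Real.sqrt_eq_rpow, mul_comm]
  rw [hv', h2, Pi.add_apply, mul_add, h1, h3, Pi.smul_apply, h4, e]
  simp
  ring

theorem IsDecomp.mem_Wstar_domain (hγ : 0 < γ) {v : L2} {w : H10} {c : ℂ}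
    (h : IsDecomp γ v w c) : v ∈ (Wstar γ).domain :=
  (mem_Wstar_domain_iff hγ).2 ⟨_, h.inner_A hγ⟩

/-- The continuous representative of an element of `H¹₀(0,1)` vanishes at `1`. -/
theorem eq_zero_of_ae_eq_of_mem_H10 {f : L2} (hf : f ∈ H10) {F : ℝ → ℂ} (hF : ContinuousOn F (Icc 0 1))
    (h : f =ᵐ[volume.restrict (Ioo (0 : ℝ) 1)] F) : F 1 = 0 := by
  obtain ⟨-, G, hG, hfG, -, h1⟩ := hf
  rw [← h1]
  refine Measure.eqOn_Icc_of_ae_eq volume (zero_ne_one' ℝ) ?_ hF hG (right_mem_Icc.2 zero_le_one)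
  rw [← restrict_Ioo_eq_restrict_Icc]
  exact h.symm.trans hfG

theorem defectVec_notMem_H10 (hγ : 0 < γ) (κ : ℝ) : defectVec hγ κ ∉ H10 := fun h => by
  have := eq_zero_of_ae_eq_of_mem_H10 h (Complex.continuous_ofReal.comp
    ((Real.continuous_rpow_const hγ.le).mul (by fun_prop))).continuousOn (coeFn_defectVec hγ κ)
  simp at this

/-- The difference puts (c − c')x^{γ+1/2} into H¹₀. It vanishes at 0 in any case, so the boundary
value at 1 decides. -/
theorem IsDecomp.unique (hγ : 0 < γ) {v : L2} {w w' : H10} {c c' : ℂ}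
    (h : IsDecomp γ v w c) (h' : IsDecomp γ v w' c') : w = w' ∧ c = c' := by
  have hc : c = c' := by
    have e : ((w' - w : H10) : L2) =ᵐ[volume.restrict (Ioo (0 : ℝ) 1)]
        fun x => (c - c') * ((x ^ (γ + 1 / 2) : ℝ) : ℂ) := by
      rw [Submodule.coe_sub]
      filter_upwards [h, h', Lp.coeFn_sub (w' : L2) (w : L2)] with x h1 h2 h3
      rw [h3, Pi.sub_apply]
      linear_combination h1 - h2
    have := eq_zero_of_ae_eq_of_mem_H10 (w' - w).2 (continuous_const.mul
      (Complex.continuous_ofReal.comp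
        (Real.continuous_rpow_const (by positivity)))).continuousOn e
    simpa [sub_eq_zero] using this
  refine ⟨Subtype.ext (Lp.ext ?_), hc⟩
  filter_upwards [h, h'] with x h1 h2
  rw [hc] at h1
  linear_combination h2 - h1

theorem mem_Wstar_domain_iff_existsUnique (hγ : 0 < γ) (v : L2) : v ∈ (Wstar γ).domain ↔
    ∃! p : H10 × ℂ, IsDecomp γ v p.1 p.2 := by
  constructor
  · intro hv
    obtain ⟨w, c, h⟩ := exists_isDecomp hγ hv
    exact ⟨(w, c), h, fun p hp => Prod.ext (hp.unique hγ h).1 (hp.unique hγ h).2⟩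
  · rintro ⟨p, hp, -⟩
    exact hp.mem_Wstar_domain hγ

/-! ### The boundary condition in terms of W* -/

theorem L2.norm_sq (f : L2) : ‖f‖ ^ 2 = ∫ x in Ioo (0 : ℝ) 1, ‖f x‖ ^ 2 := by
  have h := inner_self_eq_norm_sq_to_K (𝕜 := ℂ) f
  rw [L2.inner_eq] at h
  simp only [Complex.conj_mul'] at h
  have e : ∫ x in Ioo (0 : ℝ) 1, (‖f x‖ : ℂ) ^ 2 = ((∫ x in Ioo (0 : ℝ) 1, ‖f x‖ ^ 2 : ℝ) : ℂ) := by
    rw [← integral_complex_ofReal]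
    simp only [Complex.ofReal_pow]
  rw [e] at h
  exact Complex.ofReal_injective ((Complex.ofReal_pow _ _).trans h.symm)

theorem memLp_ofReal_rpow {r : ℝ} (hr : -(1 / 2) < r) :
    MemLp (fun x : ℝ => ((x ^ r : ℝ) : ℂ)) 2 (volume.restrict (Ioo (0 : ℝ) 1)) := by
  refine MemLp.ofReal (f := fun x : ℝ => x ^ r) ?_
  have hm : Measurable fun x : ℝ => x ^ r := by fun_prop
  rw [memLp_two_iff_integrable_sq hm.aestronglyMeasurable]
  have := intervalIntegral.intervalIntegrable_rpow' (a := 0) (b := 1) (r := r * 2) (by linarith)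
  rw [intervalIntegrable_iff_integrableOn_Ioo_of_le zero_le_one] at this
  refine this.congr ?_
  filter_upwards [ae_restrict_mem measurableSet_Ioo] with x hx
  rw [Real.rpow_mul hx.1.le, Real.rpow_two]

/-- Differentiating √(x/γ)v = γ^{-1/2}(w + c x^{γ+1/2}) and eliminating w and c expresses W*v
through v alone, as in the boundary condition. -/
theorem IsDecomp.exists_weakDeriv (hγ : 0 < γ) {v : L2} {w : H10} {c : ℂ}
    (h : IsDecomp γ v w c) : ∃ u : L2, HasWeakDeriv (invSqrtV γ v) u ∧
      ∀ᵐ x : ℝ ∂(volume.restrict (Ioo (0 : ℝ) 1)), decompAdjoint γ w x = Complex.I * u x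
        - Complex.I * (((2 * γ + 1) / (2 * √(γ * x)) : ℝ) : ℂ) * v x := by
  have n1 : (√γ : ℂ) ≠ 0 := Complex.ofReal_ne_zero.2 (Real.sqrt_pos.2 hγ).ne'
  -- The derivative of x^{γ+1/2} is a multiple of x^{γ-1/2}, which is square integrable at 0 exactly
  -- because γ > 0.
  have hm := memLp_ofReal_rpow (r := γ + 1 / 2 - 1) (by linarith)
  set k : L2 := hm.toLp _ with hk
  set u : L2 := ((√γ : ℂ)⁻¹) • (derivH10 w + (c * (γ + 1 / 2)) • k) with hu
  have hue : u =ᵐ[volume.restrict (Ioo (0 : ℝ) 1)] fun x => ((√γ : ℂ)⁻¹) * (derivH10 w x +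
      c * (((γ + 1 / 2) * x ^ (γ + 1 / 2 - 1) : ℝ) : ℂ)) := by
    filter_upwards [Lp.coeFn_smul ((√γ : ℂ)⁻¹) (derivH10 w + (c * (γ + 1 / 2)) • k),
      Lp.coeFn_add (derivH10 w) ((c * (γ + 1 / 2)) • k), Lp.coeFn_smul (c * (γ + 1 / 2)) k,
      hm.coeFn_toLp] with x h1 h2 h3 h4
    rw [h1, Pi.smul_apply, h2, Pi.add_apply, h3, Pi.smul_apply, h4, smul_eq_mul, smul_eq_mul]
    push_cast
    ring
  refine ⟨u, hasLocalWeakDeriv_iff.1 (((hasLocalWeakDeriv_decomp γ w c).mul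
    (q := fun _ => (√γ : ℂ)⁻¹) (q' := fun _ => 0) contDiffOn_const
    fun x _ => hasDerivAt_const _ _).congr ?_ ?_), ?_⟩
  · filter_upwards [coeFn_invSqrtV γ v, h, ae_restrict_mem measurableSet_Ioo] with x h1 h2 hx
    rw [h1, ← h2, Real.sqrt_div hx.1.le, Complex.ofReal_div]
    field_simp
  · filter_upwards [hue] with x h1
    rw [h1]; ring
  · filter_upwards [hue, h, coeFn_decompAdjoint γ w, ae_restrict_mem measurableSet_Ioo]
      with x h1 h2 h3 hx
    have e2 : (√x : ℂ) ^ 2 = x := by exact_mod_cast Real.sq_sqrt hx.1.le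
    have n2 : (√x : ℂ) ≠ 0 := Complex.ofReal_ne_zero.2 (Real.sqrt_pos.2 hx.1).ne'
    have hv : v x = ((w : L2) x + c * ((x ^ (γ + 1 / 2) : ℝ) : ℂ)) / (√x : ℂ) := by
      rw [← h2]; field_simp
    rw [h3, h1, hv, Real.sqrt_mul hγ.le, Real.rpow_sub_one hx.1.ne']
    push_cast
    rw [← e2]
    field_simp
    ring

theorem IsDecomp.boundaryCondition_iff (hγ : 0 < γ) {v : L2} {w : H10} {c : ℂ}
    (h : IsDecomp γ v w c) (ℓ : L2) : BoundaryCondition γ v ℓ ↔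
      1 / 4 * ‖invSqrtV γ ℓ - decompAdjoint γ w‖ ^ 2 ≤ (inner ℂ v ℓ).im := by
  obtain ⟨u, hu, hs⟩ := h.exists_weakDeriv hγ
  have e : ∫ x in Ioo (0 : ℝ) 1, ‖((√(x / γ) : ℝ) : ℂ) * ℓ x - Complex.I * u x
        + Complex.I * (((2 * γ + 1) / (2 * √(γ * x)) : ℝ) : ℂ) * v x‖ ^ 2
      = ‖invSqrtV γ ℓ - decompAdjoint γ w‖ ^ 2 := by
    rw [L2.norm_sq]
    refine integral_congr_ae ?_
    filter_upwards [hs, coeFn_invSqrtV γ ℓ, Lp.coeFn_sub (invSqrtV γ ℓ) (decompAdjoint γ w)]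
      with x h1 h2 h3
    rw [h3, Pi.sub_apply, h1, h2]
    congr 2
    ring
  constructor
  · rintro ⟨u', hu', hle⟩
    obtain rfl := hu.unique hu'
    rwa [e] at hle
  · exact fun hle => ⟨u, hu, by rwa [e]⟩

/-! ### The quadratic form on H¹₀ + span{v} -/

theorem inner_H10_eq (hγ : 0 < γ) (f : H10) (ℓ : L2) :
    inner ℂ (f : L2) ℓ = inner ℂ (sqrtV γ f) (invSqrtV γ ℓ) := by
  nth_rewrite 1 [← invSqrtV_sqrtV hγ f]
  exact inner_invSqrtV γ _ _

/-- The cross term ⟨f, ℓ⟩ equals ⟨V^{1/2}f, V^{-1/2}ℓ⟩, so both cross terms merge into one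
functional that can be compared with ‖V^{1/2}f‖. -/
theorem im_inner_add_smul (hγ : 0 < γ) (f : H10) (v ℓ : L2) (c : ℂ) :
    (inner ℂ ((f : L2) + c • v) (A γ f + c • ℓ)).im = ‖sqrtV γ f‖ ^ 2
      + ((starRingEnd ℂ) c * (inner ℂ v (A γ f) - inner ℂ (invSqrtV γ ℓ) (sqrtV γ f))).im
      + ‖c‖ ^ 2 * (inner ℂ v ℓ).im := by
  have e1 : (c * inner ℂ (f : L2) ℓ).im
      = -((starRingEnd ℂ) c * inner ℂ (invSqrtV γ ℓ) (sqrtV γ f)).im := by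
    rw [inner_H10_eq hγ, ← Complex.conj_im, map_mul, Complex.conj_conj, inner_conj_symm]
  have e2 : ((starRingEnd ℂ) c * (c * inner ℂ v ℓ)).im = ‖c‖ ^ 2 * (inner ℂ v ℓ).im := by
    rw [← mul_assoc, Complex.conj_mul', ← Complex.ofReal_pow, Complex.im_ofReal_mul]
  rw [inner_add_left, inner_add_right, inner_add_right, inner_smul_left, inner_smul_left,
    inner_smul_right, inner_smul_right, Complex.add_im, Complex.add_im, Complex.add_im,
    im_inner_A hγ, e1, e2, mul_sub, Complex.sub_im]
  ring

/-- A number `T` with `‖z‖² a² + Im (z T) + C ≥ 0` for all `z` is bounded by `(1 + C) a`. -/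
theorem norm_le_of_forall_im_ge {T : ℂ} {a C : ℝ} (ha : 0 < a)
    (h : ∀ z : ℂ, 0 ≤ ‖z‖ ^ 2 * a ^ 2 + (z * T).im + C) : ‖T‖ ≤ (1 + C) * a := by
  rcases eq_or_ne T 0 with rfl | hT
  · have := h (1 / a)
    rw [norm_zero]
    have e : ‖(1 / a : ℂ)‖ ^ 2 * a ^ 2 = 1 := by
      rw [norm_div, norm_one, Complex.norm_real, Real.norm_of_nonneg ha.le]
      field_simp
    rw [e] at this
    simp only [mul_zero, Complex.zero_im, add_zero] at this
    positivity
  have hn : 0 < ‖T‖ := norm_pos_iff.2 hT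
  -- The phase of z is chosen so that Im(zT) = −‖T‖/a, and its modulus so that ‖z‖a = 1.
  have hz : (-Complex.I * (starRingEnd ℂ) T / (‖T‖ * a)) * T = -((‖T‖ / a : ℝ) : ℂ) * Complex.I := by
    have : (starRingEnd ℂ) T * T = (‖T‖ : ℂ) ^ 2 := Complex.conj_mul' T
    have n1 : (‖T‖ : ℂ) ≠ 0 := Complex.ofReal_ne_zero.2 hn.ne'
    have n2 : (a : ℂ) ≠ 0 := Complex.ofReal_ne_zero.2 ha.ne'
    push_cast
    field_simp
    linear_combination (-1 : ℂ) * this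
  have hz' : ‖-Complex.I * (starRingEnd ℂ) T / (‖T‖ * a)‖ = 1 / a := by
    rw [norm_div, norm_mul, norm_neg, Complex.norm_I, RCLike.norm_conj, norm_mul, Complex.norm_real,
      Complex.norm_real, norm_norm, Real.norm_of_nonneg ha.le]
    field_simp
  have := h (-Complex.I * (starRingEnd ℂ) T / (‖T‖ * a))
  rw [hz, hz'] at this
  have e : (-((‖T‖ / a : ℝ) : ℂ) * Complex.I).im = -(‖T‖ / a) := by
    rw [← Complex.ofReal_neg, Complex.im_ofReal_mul, Complex.I_im, mul_one]
  rw [e] at this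
  have e3 : (1 / a) ^ 2 * a ^ 2 = 1 := by field_simp
  rw [e3] at this
  rw [← div_le_iff₀ ha]
  linarith

theorem exists_sqrtV_eq (hγ : 0 < γ) (g : (W γ).domain) :
    ∃ f : H10, sqrtV γ f = g ∧ W γ g = A γ f := by
  have hg : invSqrtV γ (g : L2) ∈ (A₀ γ).domain := g.2
  rw [A₀_domain] at hg
  exact ⟨⟨_, testSpace_le_H10 hg⟩, sqrtV_eq_of_invSqrtV_eq hγ rfl, W_apply γ g _ rfl⟩

/-- Already c = 1 suffices: scaling f shows that ⟨v, Af⟩ is bounded in terms of ‖V^{1/2}f‖, and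
minimising over the dense set of vectors V^{1/2}f gives the inequality. -/
theorem mem_Wstar_and_boundaryCondition (hγ : 0 < γ) {v ℓ : L2}
    (h : ∀ (f : H10) (c : ℂ), 0 ≤ (inner ℂ ((f : L2) + c • v) (A γ f + c • ℓ)).im) :
    v ∈ (Wstar γ).domain ∧ BoundaryCondition γ v ℓ := by
  set C := (inner ℂ v ℓ).im with hC
  set m := invSqrtV γ ℓ with hm
  have hq : ∀ f : H10, 0 ≤ ‖sqrtV γ f‖ ^ 2
      + (inner ℂ v (A γ f) - inner ℂ m (sqrtV γ f)).im + C := by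
    intro f
    have := h f 1
    rw [im_inner_add_smul hγ] at this
    simpa using this
  have hb : ∀ f : H10, ‖inner ℂ v (A γ f) - inner ℂ m (sqrtV γ f)‖ ≤ (1 + C) * ‖sqrtV γ f‖ := by
    intro f
    rcases (norm_nonneg (sqrtV γ f)).eq_or_lt with h0 | h0
    · have hf : f = 0 := by
        have := invSqrtV_sqrtV hγ f
        rw [norm_eq_zero.1 h0.symm, map_zero] at this
        exact Subtype.ext this.symm
      subst hf
      have : A γ (0 : H10) = 0 := map_zero _
      rw [this]
      simp
    · refine norm_le_of_forall_im_ge h0 fun z => ?_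
      have e1 : A γ (z • f) = z • A γ f := map_smul _ _ _
      have := hq (z • f)
      rw [e1, map_smul, inner_smul_right, inner_smul_right, ← mul_sub, norm_smul, mul_pow] at this
      exact this
  have hv : v ∈ (Wstar γ).domain := by
    refine (LinearPMap.mem_adjoint_domain_iff _ _).2
      (AddMonoidHomClass.continuous_of_bound _ (1 + C + ‖m‖) fun g => ?_)
    obtain ⟨f, hf, hW⟩ := exists_sqrtV_eq hγ g
    change ‖inner ℂ v (W γ g)‖ ≤ _ * ‖(g : L2)‖
    rw [hW, ← hf]
    calc ‖inner ℂ v (A γ f)‖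
        = ‖(inner ℂ v (A γ f) - inner ℂ m (sqrtV γ f)) + inner ℂ m (sqrtV γ f)‖ := by
          rw [sub_add_cancel]
      _ ≤ _ := (norm_add_le _ _).trans (add_le_add (hb f) (norm_inner_le_norm _ _))
      _ = _ := by ring
  refine ⟨hv, ?_⟩
  obtain ⟨w, c, hd⟩ := exists_isDecomp hγ hv
  rw [hd.boundaryCondition_iff hγ, ← hC, ← hm]
  set s := decompAdjoint γ w with hs
  -- Once W*v exists the form is continuous in g = V^{1/2}f, so nonnegativity passes from D(W) to
  -- all of L².
  have hall : ∀ g : L2, 0 ≤ ‖g‖ ^ 2 + (inner ℂ (s - m) g).im + C := by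
    intro g
    have hcl : IsClosed {g : L2 | 0 ≤ ‖g‖ ^ 2 + (inner ℂ (s - m) g).im + C} :=
      isClosed_le continuous_const (((continuous_norm.pow 2).add
        (Complex.continuous_im.comp (continuous_const.inner continuous_id))).add continuous_const)
    refine hcl.closure_subset_iff.2 ?_ (dense_W_domain hγ g)
    intro g hg
    obtain ⟨f, hf, -⟩ := exists_sqrtV_eq hγ ⟨g, hg⟩
    have := hq f
    rw [hd.inner_A hγ, ← inner_sub_left, hf] at this
    exact this
  -- The minimiser of ‖g‖² + Im⟨s − m, g⟩, with minimum −‖s − m‖²/4; this is the source of the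
  -- factor 1/4.
  have := hall ((-(Complex.I / 2)) • (s - m))
  rw [inner_smul_right, inner_self_eq_norm_sq_to_K, norm_smul] at this
  have e1 : (-(Complex.I / 2) * ((‖s - m‖ : ℝ) : ℂ) ^ 2).im = -(‖s - m‖ ^ 2 / 2) := by
    rw [← Complex.ofReal_pow, mul_comm, Complex.im_ofReal_mul]
    simp
    ring
  have e2 : ‖-(Complex.I / 2)‖ = 1 / 2 := by simp
  rw [norm_sub_rev]
  rw [e2] at this
  erw [e1] at this
  linarith

theorem im_inner_nonneg (hγ : 0 < γ) {v ℓ : L2} (hv : v ∈ (Wstar γ).domain)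
    (hb : BoundaryCondition γ v ℓ) (f : H10) (c : ℂ) :
    0 ≤ (inner ℂ ((f : L2) + c • v) (A γ f + c • ℓ)).im := by
  obtain ⟨w, a, hd⟩ := exists_isDecomp hγ hv
  rw [hd.boundaryCondition_iff hγ] at hb
  rw [im_inner_add_smul hγ, hd.inner_A hγ, ← inner_sub_left]
  set h := decompAdjoint γ w - invSqrtV γ ℓ with hh
  rw [norm_sub_rev, ← hh] at hb
  have h1 : -(‖c‖ * (‖h‖ * ‖sqrtV γ f‖)) ≤ ((starRingEnd ℂ) c * inner ℂ h (sqrtV γ f)).im := by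
    refine (abs_le.1 ((Complex.abs_im_le_norm _).trans ?_)).1
    rw [norm_mul, RCLike.norm_conj]
    exact mul_le_mul_of_nonneg_left (norm_inner_le_norm _ _) (norm_nonneg _)
  have h2 := mul_le_mul_of_nonneg_left hb (sq_nonneg ‖c‖)
  -- Completing the square: ‖V^{1/2}f‖² − |c|‖h‖‖V^{1/2}f‖ + |c|²‖h‖²/4 is a perfect square.
  nlinarith [sq_nonneg (‖sqrtV γ f‖ - ‖c‖ * ‖h‖ / 2)]

/-! ### One-dimensional extensions and maximality -/

theorem dense_H10 : Dense (H10 : Set L2) := dense_testSpace.mono testSpace_le_H10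

theorem A_le_Aext (γ : ℝ) (v ℓ : L2) (hv : v ∉ H10) : A γ ≤ Aext γ v ℓ hv :=
  ⟨le_sup_left, fun x y h =>
    ((LinearPMap.supSpanSingleton_apply_of_mem (A γ) ℓ hv y (h ▸ x.2)).trans
      (congrArg (A γ) (Subtype.ext h.symm))).symm⟩

theorem mem_Aext_domain {v ℓ : L2} {hv : v ∉ H10} {x : L2} :
    x ∈ (Aext γ v ℓ hv).domain ↔ ∃ (f : H10) (c : ℂ), (f : L2) + c • v = x := by
  change x ∈ H10 ⊔ Submodule.span ℂ {v} ↔ _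
  simp only [Submodule.mem_sup, Submodule.mem_span_singleton]
  constructor
  · rintro ⟨f, hf, _, ⟨c, rfl⟩, rfl⟩
    exact ⟨⟨f, hf⟩, c, rfl⟩
  · rintro ⟨f, c, rfl⟩
    exact ⟨f, f.2, _, ⟨c, rfl⟩, rfl⟩

theorem isDissipative_Aext (hγ : 0 < γ) {v ℓ : L2} {hv : v ∉ H10} (hW : v ∈ (Wstar γ).domain)
    (hb : BoundaryCondition γ v ℓ) : IsDissipative (Aext γ v ℓ hv) := by
  refine ⟨dense_H10.mono (A_le_Aext γ v ℓ hv).1, ?_⟩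
  rintro ⟨x, hx⟩
  obtain ⟨f, c, rfl⟩ := mem_Aext_domain.1 hx
  rw [Aext_apply]
  exact im_inner_nonneg hγ hW hb f c

theorem apply_add_smul {B : L2 →ₗ.[ℂ] L2} (hAB : A γ ≤ B) (f : H10) {v : L2} (hv : v ∈ B.domain)
    (c : ℂ) (h : (f : L2) + c • v ∈ B.domain) :
    B ⟨(f : L2) + c • v, h⟩ = A γ f + c • B ⟨v, hv⟩ := by
  have hf : (f : L2) ∈ B.domain := hAB.1 f.2
  have e : (⟨(f : L2) + c • v, h⟩ : B.domain) = ⟨f, hf⟩ + c • ⟨v, hv⟩ := rfl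
  rw [e, B.map_add, B.map_smul, ← hAB.2 (x := f) (y := ⟨f, hf⟩) rfl]

/-- Bx = −ix would give Im⟨x, Bx⟩ = −‖x‖², so B + i is injective. -/
theorem eq_zero_of_isDissipative {B : L2 →ₗ.[ℂ] L2} (hB : IsDissipative B) (x : B.domain)
    (h : B x + Complex.I • (x : L2) = 0) : x = 0 := by
  have h1 := hB.2 x
  have h2 : B x = (-Complex.I) • (x : L2) := by rw [neg_smul]; exact eq_neg_of_add_eq_zero_left h
  rw [h2, inner_smul_right, inner_self_eq_norm_sq_to_K] at h1
  have e : (-Complex.I * ((‖(x : L2)‖ : ℝ) : ℂ) ^ 2).im = -‖(x : L2)‖ ^ 2 := by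
    rw [← Complex.ofReal_pow, mul_comm, Complex.im_ofReal_mul]
    simp
  erw [e] at h1
  have : ‖(x : L2)‖ ^ 2 = 0 := le_antisymm (by linarith) (sq_nonneg _)
  exact Subtype.ext (norm_eq_zero.1 (pow_eq_zero_iff two_ne_zero |>.1 this))

/-- A dissipative extension of `A` extends it by at most one dimension. -/
theorem exists_sub_smul_mem_H10 (hγ : 0 < γ) {B : L2 →ₗ.[ℂ] L2} (hAB : A γ ≤ B)
    (hB : IsDissipative B) {v x : L2} (hv : v ∈ B.domain) (hx : x ∈ B.domain) (hvH : v ∉ H10) :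
    ∃ c : ℂ, x - c • v ∈ H10 := by
  -- Orthogonality to x^γ e^x gives (B + i)y = (A + i)f = (B + i)f for some f ∈ H¹₀, and injectivity
  -- of B + i forces y = f.
  have key : ∀ y : B.domain,
      inner ℂ (defectVec hγ 1) (B y + Complex.I • (y : L2)) = 0 → (y : L2) ∈ H10 := by
    intro y hy
    obtain ⟨f, hf⟩ := exists_A_add_smul_eq_of_inner hγ zero_le_one hy
    have hfB : (f : L2) ∈ B.domain := hAB.1 f.2
    have hz := eq_zero_of_isDissipative hB (y - ⟨f, hfB⟩) (by
      rw [B.map_sub, ← hAB.2 (x := f) (y := ⟨f, hfB⟩) rfl, Submodule.coe_sub, smul_sub]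
      rw [Complex.ofReal_one, mul_one] at hf
      rw [sub_add_sub_comm, ← hf, sub_self])
    rw [sub_eq_zero.1 hz]
    exact f.2
  -- The kernel of this one linear functional lies in H¹₀, so the quotient of D(B) by H¹₀ has
  -- dimension at most one.
  set L : B.domain → ℂ := fun y => inner ℂ (defectVec hγ 1) (B y + Complex.I • (y : L2)) with hL
  have hLv : L ⟨v, hv⟩ ≠ 0 := fun h => hvH (key _ h)
  refine ⟨L ⟨x, hx⟩ / L ⟨v, hv⟩, key (⟨x, hx⟩ - (L ⟨x, hx⟩ / L ⟨v, hv⟩) • ⟨v, hv⟩) ?_⟩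
  set a := L ⟨x, hx⟩ / L ⟨v, hv⟩ with ha
  have e : B (⟨x, hx⟩ - a • ⟨v, hv⟩) + Complex.I • ((⟨x, hx⟩ - a • ⟨v, hv⟩ : B.domain) : L2)
      = (B ⟨x, hx⟩ + Complex.I • x) - a • (B ⟨v, hv⟩ + Complex.I • v) := by
    rw [B.map_sub, B.map_smul, Submodule.coe_sub, Submodule.coe_smul]
    module
  rw [e, inner_sub_right, inner_smul_right]
  change L ⟨x, hx⟩ - a * L ⟨v, hv⟩ = 0
  rw [ha, div_mul_cancel₀ _ hLv, sub_self]

theorem eq_Aext_of_isDissipative (hγ : 0 < γ) {B : L2 →ₗ.[ℂ] L2} (hAB : A γ ≤ B)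
    (hB : IsDissipative B) {v : L2} (hv : v ∈ B.domain) (hvH : v ∉ H10) :
    B = Aext γ v (B ⟨v, hv⟩) hvH := by
  have hle : Aext γ v (B ⟨v, hv⟩) hvH ≤ B := by
    refine ⟨?_, ?_⟩
    · intro x hx
      obtain ⟨f, c, rfl⟩ := mem_Aext_domain.1 hx
      exact B.domain.add_mem (hAB.1 f.2) (B.domain.smul_mem c hv)
    · rintro ⟨x, hx⟩ ⟨y, hy⟩ (rfl : x = y)
      obtain ⟨f, c, rfl⟩ := mem_Aext_domain.1 hx
      rw [Aext_apply, apply_add_smul hAB f hv]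
  refine (LinearPMap.eq_of_le_of_domain_eq hle (le_antisymm hle.1 fun x hx => ?_)).symm
  obtain ⟨c, hc⟩ := exists_sub_smul_mem_H10 hγ hAB hB hv hx hvH
  exact mem_Aext_domain.2 ⟨⟨_, hc⟩, c, sub_add_cancel _ _⟩

/-- A dissipative extension S also extends A, so the dimension count applied to S leaves no room
beyond H¹₀ + span{v}. -/
theorem isMaximallyDissipative_Aext (hγ : 0 < γ) {v ℓ : L2} {hv : v ∉ H10}
    (hB : IsDissipative (Aext γ v ℓ hv)) : IsMaximallyDissipative (Aext γ v ℓ hv) := by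
  refine ⟨hB, fun S hS hle => ?_⟩
  have hAS := (A_le_Aext γ v ℓ hv).trans hle
  have hvA : v ∈ (Aext γ v ℓ hv).domain := mem_Aext_domain.2 ⟨0, 1, by simp⟩
  refine (LinearPMap.eq_of_le_of_domain_eq hle (le_antisymm hle.1 fun x hx => ?_)).symm
  obtain ⟨c, hc⟩ := exists_sub_smul_mem_H10 hγ hAS hS (hle.1 hvA) hx hv
  exact mem_Aext_domain.2 ⟨⟨_, hc⟩, c, sub_add_cancel _ _⟩

theorem isDecomp_defectVec (hγ : 0 < γ) : IsDecomp γ (defectVec hγ 0) 0 1 := by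
  filter_upwards [coeFn_defectVec hγ 0, ae_restrict_mem measurableSet_Ioo,
    Lp.coeFn_zero ℂ 2 (volume.restrict (Ioo (0 : ℝ) 1))] with x h1 hx h0
  have e : x ^ (γ + 1 / 2) = √x * x ^ γ := by
    rw [Real.rpow_add hx.1, ← Real.sqrt_eq_rpow, mul_comm]
  rw [h1, e, Submodule.coe_zero, h0]
  simp

/-- For v = x^γ the decomposition has w = 0, so W*v = 0; with ℓ = 0 both sides of the boundary
condition vanish. -/
theorem isDissipative_Aext_defectVec (hγ : 0 < γ) :
    IsDissipative (Aext γ (defectVec hγ 0) 0 (defectVec_notMem_H10 hγ 0)) := by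
  have h := isDecomp_defectVec hγ
  refine isDissipative_Aext hγ (h.mem_Wstar_domain hγ) ((h.boundaryCondition_iff hγ 0).2 ?_)
  simp [decompAdjoint]

/-- Otherwise B = A, which is not maximal because it has the proper dissipative extension with v =
x^γ and ℓ = 0. -/
theorem exists_mem_domain_notMem_H10 (hγ : 0 < γ) {B : L2 →ₗ.[ℂ] L2} (hAB : A γ ≤ B)
    (hB : IsMaximallyDissipative B) : ∃ v ∈ B.domain, v ∉ H10 := by
  by_contra! h
  obtain rfl : A γ = B := LinearPMap.eq_of_le_of_domain_eq hAB (le_antisymm hAB.1 h)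
  have e := hB.2 _ (isDissipative_Aext_defectVec hγ) (A_le_Aext _ _ _ _)
  refine defectVec_notMem_H10 hγ 0 (h _ ?_)
  rw [← e]
  exact mem_Aext_domain.2 ⟨0, 1, by simp⟩

theorem isMaximallyDissipative_extension_iff (hγ : 0 < γ) (B : L2 →ₗ.[ℂ] L2) :
    (A γ ≤ B ∧ IsMaximallyDissipative B) ↔ ∃ (v ℓ : L2) (hv : v ∉ H10),
      v ∈ (Wstar γ).domain ∧ BoundaryCondition γ v ℓ ∧ B = Aext γ v ℓ hv := by
  constructor
  · rintro ⟨hAB, hB⟩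
    obtain ⟨v, hv, hvH⟩ := exists_mem_domain_notMem_H10 hγ hAB hB
    obtain ⟨h1, h2⟩ := mem_Wstar_and_boundaryCondition hγ (v := v) (ℓ := B ⟨v, hv⟩) fun f c => by
      have hm : (f : L2) + c • v ∈ B.domain :=
        B.domain.add_mem (hAB.1 f.2) (B.domain.smul_mem c hv)
      rw [← apply_add_smul hAB f hv c hm]
      exact hB.1.2 ⟨_, hm⟩
    exact ⟨v, B ⟨v, hv⟩, hvH, h1, h2, eq_Aext_of_isDissipative hγ hAB hB.1 hv hvH⟩
  · rintro ⟨v, ℓ, hv, h1, h2, rfl⟩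
    exact ⟨A_le_Aext γ v ℓ hv, isMaximallyDissipative_Aext hγ (isDissipative_Aext hγ h1 h2)⟩

end SingularFirstOrder


theorem proposition5p1 (γ : ℝ) (hγ : 0 < γ) :
    (∀ v : SingularFirstOrder.L2, v ∈ (SingularFirstOrder.Wstar γ).domain ↔
      ∃! p : SingularFirstOrder.H10 × ℂ,
        ∀ᵐ x : ℝ ∂(volume.restrict (Ioo (0 : ℝ) 1)),
          ((√x : ℝ) : ℂ) * v x
            = (p.1 : SingularFirstOrder.L2) x + p.2 * ((x ^ (γ + 1 / 2) : ℝ) : ℂ)) ∧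
    (∀ B : SingularFirstOrder.L2 →ₗ.[ℂ] SingularFirstOrder.L2,
      (SingularFirstOrder.A γ ≤ B ∧ SingularFirstOrder.IsMaximallyDissipative B) ↔
        ∃ (v ℓ : SingularFirstOrder.L2) (hv : v ∉ SingularFirstOrder.H10),
          v ∈ (SingularFirstOrder.Wstar γ).domain ∧
          SingularFirstOrder.BoundaryCondition γ v ℓ ∧
          B = SingularFirstOrder.Aext γ v ℓ hv) :=
  ⟨SingularFirstOrder.mem_Wstar_domain_iff_existsUnique hγ,
    SingularFirstOrder.isMaximallyDissipative_extension_iff hγ⟩
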